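/- Let $R$ be a nonzero associative ring with unity; all modules are left $R$-modules. For an infinite cardinal $\kappa$, $R$ is left $(<\kappa)$-noetherian if every left ideal of $R$ can be generated by fewer than $\kappa$ elements. For modules $P\subseteq Q$, $Q$ is universal over $P$ if $|Q|=|P|$ and for every module $E\supseteq P$ with $|E|=|Q|$ there is an injective homomorphism $E\to Q$ that is the identity on $P$. For an infinite cardinal $\lambda$ and a (nonzero) limit ordinal $\alpha<\lambda^+$, a module $M$ is a $(\lambda,\alpha)$-limit model if $M=\bigcup_{i<\alpha}M_i$ for an increasing chain $(M_i)_{i<\alpha}$ of modules of cardinality $\lambda$ such that $M_i=\bigcup_{j<i}M_j$ for every limit ordinal $i<\alpha$ and $M_{i+1}$ is universal over $M_i$ for every $i<\alpha$. A $\lambda$-limit model is a module that is a $(\lambda,\alpha)$-limit model for some limit ordinal $\alpha<\lambda^+$. The class of $R$-modules with embeddings is stable in $\lambda$ if there is a $\lambda$-limit model. Theorem. Let $n\ge 0$ be an integer. The following are equivalent. 1. $R$ is left $(<\aleph_n)$-noetherian and, if $n\ge 1$, $R$ is not left $(<\aleph_{n-1})$-noetherian. 2. For every cardinal $\lambda\ge(\operatorname{card}(R)+\aleph_0)^+$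 such that the class of $R$-modules with embeddings is stable in $\lambda$, there are, up to isomorphism, exactly $n+1$ $\lambda$-limit models. 3. There are, up to isomorphism, exactly $n+1$ $2^{\operatorname{card}(R)+\aleph_0}$-limit models. -/

import Mathlib

open scoped Cardinal

universe u

/-- A left ideal is `(< κ)`-generated if it is generated by a set of fewer than `κ` elements.
(For a not necessarily commutative ring `R`, `Ideal R` is the type of left ideals.) -/
def IsLTGenerated {R : Type u} [Ring R] (κ : Cardinal.{u}) (I : Ideal R) : Prop :=
  ∃ s : Set R, #s < κ ∧ Ideal.span s = I

/-- `R` is left `(< κ)`-noetherian if every left ideal is `(< κ)`-generated. -/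
def IsLeftLTNoetherian (R : Type u) [Ring R] (κ : Cardinal.{u}) : Prop :=
  ∀ I : Ideal R, IsLTGenerated κ I

/-- For submodules `P`, `Q` of a module: `Q` is universal over `P`, that is, `P ⊆ Q`, `‖Q‖ = ‖P‖`,
and every extension `E` of `P` of cardinality `‖Q‖` embeds into `Q` over `P`.
An extension of `P` is given as a module `E` with an embedding `j : P → E`; up to replacing `E` by
an isomorphic copy, `j` is an inclusion. -/
def IsUniversalOver {R : Type u} [Ring R] {M : Type u} [AddCommGroup M] [Module R M]
    (Q P : Submodule R M) : Prop :=
  P ≤ Q ∧ #Q = #P ∧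
    ∀ (E : Type u) [AddCommGroup E] [Module R E], #E = #Q →
      ∀ j : P →ₗ[R] E, Function.Injective j →
        ∃ f : E →ₗ[R] Q, Function.Injective f ∧ ∀ x : P, (f (j x) : M) = (x : M)

/-- `c` restricted to the ordinals below `α` is an increasing continuous chain, starting at `N` and
with union `M`, that witnesses that `M` is a `(lam, α)`-limit model over `N`. -/
structure IsLimitChain {R : Type u} [Ring R] {M : Type u} [AddCommGroup M] [Module R M]
    (lam : Cardinal.{u}) (α : Ordinal.{u}) (N : Submodule R M)
    (c : Ordinal.{u} → Submodule R M) : Prop where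
  card_eq : ∀ i < α, #(c i) = lam
  mono : ∀ i j, i ≤ j → j < α → c i ≤ c j
  continuous : ∀ i < α, Order.IsSuccLimit i → (c i : Set M) = ⋃ j < i, (c j : Set M)
  zero : c 0 = N
  union : ⋃ i < α, (c i : Set M) = Set.univ
  universal : ∀ i < α, IsUniversalOver (c (Order.succ i)) (c i)

/-- `M` is a `(lam, α)`-limit model over its submodule `N`, where `lam` is an infinite cardinal and
`α < lam⁺` is a limit ordinal (in particular `α ≠ 0`). -/
def IsLimitModelOver {R : Type u} [Ring R] {M : Type u} [AddCommGroup M] [Module R M]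
    (lam : Cardinal.{u}) (α : Ordinal.{u}) (N : Submodule R M) : Prop :=
  ℵ₀ ≤ lam ∧ Order.IsSuccLimit α ∧ α < (Order.succ lam).ord ∧
    ∃ c : Ordinal.{u} → Submodule R M, IsLimitChain lam α N c

/-- `M` is a `lam`-limit model: a `(lam, α)`-limit model over some `N`, for some limit ordinal
`α < lam⁺`. -/
def IsLimitModel (R : Type u) [Ring R] (lam : Cardinal.{u})
    (M : Type u) [AddCommGroup M] [Module R M] : Prop :=
  ∃ (α : Ordinal.{u}) (N : Submodule R M), IsLimitModelOver lam α N

/-- The class of left `R`-modules with embeddings is stable in `lam` if there is a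
`lam`-limit model. -/
def IsStableIn (R : Type u) [Ring R] (lam : Cardinal.{u}) : Prop :=
  ∃ M : ModuleCat.{u} R, IsLimitModel R lam M

/-- The number of `lam`-limit models up to isomorphism: the cardinality of the collection of
isomorphism classes of left `R`-modules that contain a `lam`-limit model. -/
noncomputable def numLimitModels (R : Type u) [Ring R] (lam : Cardinal.{u}) : Cardinal.{u + 1} :=
  #{C : Quotient (CategoryTheory.isIsomorphicSetoid (ModuleCat.{u} R)) |
      ∃ M : ModuleCat.{u} R, IsLimitModel R lam M ∧ Quotient.mk _ M = C}

/-! A limit model of length `α` is the union of a chain of regular length `κ = cof α ≤ lam`, each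
term universal over the previous ones (`IsUnivChain`). By back-and-forth the union depends only on
`κ` up to isomorphism (`IsUnivChain.nonempty_linearEquiv`), so it remains to decide which `κ` give
isomorphic unions.

If `R` is left `(< κ)`-noetherian, a homomorphism from a left ideal to the union lands in one term
of the chain, hence extends to `R`; by Baer the union is injective. Unions of this kind embed in
each other, and mutually embeddable injective modules are isomorphic
(`Module.Injective.nonempty_linearEquiv`). So all `κ` from the noetherian threshold on give a single
model. If `R` is not left `(< κ)`-noetherian and `κ < κ'`, some homomorphism from an ideal with `κ`
generators into the `κ`-union does not extend to `R`, while all such homomorphisms into the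
`κ'`-union do (`IsUnivChain.isEmpty_linearEquiv`).

With threshold `ℵ_n` the models are those for `ℵ_0, …, ℵ_(n-1)` and one for all larger `κ`. The two
resulting bounds, `numLimitModels_le` and `le_numLimitModels`, together with stability in `2 ^ (#R +
ℵ₀)`, give the equivalence. -/

/-! ### Transfinite chains -/

/-- Transfinite construction of a continuous increasing chain in a complete lattice. -/
theorem exists_transfinite_chain {L : Type*} [CompleteLattice L] (θ : Ordinal.{u})
    (P : Ordinal.{u} → L → Prop) (S : Ordinal.{u} → L → L → Prop) (x₀ : L) (h0 : P 0 x₀)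
    (hs : ∀ i < θ, ∀ x, P i x → ∃ y, x ≤ y ∧ P (Order.succ i) y ∧ S i x y)
    (hl : ∀ i ≤ θ, Order.IsSuccLimit i → ∀ g : Ordinal.{u} → L, Monotone g →
      (∀ j < i, P j (g j)) → P i (⨆ j : Set.Iio i, g j)) :
    ∃ g : Ordinal.{u} → L, g 0 = x₀ ∧ Monotone g ∧ (∀ i ≤ θ, P i (g i)) ∧
      (∀ i < θ, S i (g i) (g (Order.succ i))) ∧
      ∀ i, Order.IsSuccLimit i → g i = ⨆ j : Set.Iio i, g j := by
  classical
  -- Staying at `x` when no good extension exists makes the recursion total and monotone everywhere;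
  -- `P` is recovered afterwards, up to `θ` only.
  let step : Ordinal.{u} → L → L := fun i x =>
    if h : ∃ y, x ≤ y ∧ P (Order.succ i) y ∧ S i x y then h.choose else x
  have le_step : ∀ i x, x ≤ step i x := by
    intro i x
    by_cases h : ∃ y, x ≤ y ∧ P (Order.succ i) y ∧ S i x y
    · simp only [step, dif_pos h]; exact h.choose_spec.1
    · simp only [step, dif_neg h]; exact le_rfl
  let g : Ordinal.{u} → L := fun i => Ordinal.limitRecOn (motive := fun _ => L) i x₀
    (fun i x => step i x) (fun i _ ih => ⨆ j : Set.Iio i, ih j j.2)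
  have g0 : g 0 = x₀ := Ordinal.limitRecOn_zero _ _ _
  have gs : ∀ i, g (Order.succ i) = step i (g i) := fun i => Ordinal.limitRecOn_add_one i _ _ _
  have gl : ∀ i, Order.IsSuccLimit i → g i = ⨆ j : Set.Iio i, g j :=
    fun i hi => Ordinal.limitRecOn_limit i _ _ _ hi
  have gm : Monotone g := by
    have : ∀ k, ∀ j < k, g j ≤ g k := by
      intro k
      induction k using Ordinal.limitRecOn with
      | zero => intro j hj; exact absurd hj (not_lt_bot)
      | add_one k ih =>
        intro j hj
        have hj' : j ≤ k := Order.lt_succ_iff.1 hj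
        have h1 : g k ≤ g (Order.succ k) := by rw [gs]; exact le_step _ _
        rcases hj'.lt_or_eq with h | rfl
        · exact (ih j h).trans h1
        · exact h1
      | limit k hk ih =>
        intro j hj
        rw [gl k hk]
        exact le_iSup (fun j : Set.Iio k => g j) ⟨j, hj⟩
    intro j k hjk
    rcases hjk.lt_or_eq with h | rfl
    · exact this k j h
    · exact le_rfl
  have stepspec : ∀ i < θ, P i (g i) →
      P (Order.succ i) (g (Order.succ i)) ∧ S i (g i) (g (Order.succ i)) := by
    intro i hi hP
    have h := hs i hi _ hP
    rw [gs]
    simp only [step, dif_pos h]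
    exact h.choose_spec.2
  have gP : ∀ i, i ≤ θ → P i (g i) := by
    intro i
    induction i using Ordinal.limitRecOn with
    | zero => intro _; rw [g0]; exact h0
    | add_one k ih =>
      intro hk
      have hk' : k < θ := Order.succ_le_iff.1 hk
      exact (stepspec k hk' (ih hk'.le)).1
    | limit k hk ih =>
      intro hkθ
      rw [gl k hk]
      exact hl k hkθ hk g gm fun j hj => ih j hj (hj.le.trans hkθ)
  exact ⟨g, g0, gm, gP, fun i hi => (stepspec i hi (gP i hi.le)).2, gl⟩

/-- Membership in the union of a chain of submodules at a limit ordinal. -/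
theorem Submodule.mem_iSup_Iio {R M : Type*} [Ring R] [AddCommGroup M] [Module R M]
    {i : Ordinal.{u}} (hi : Order.IsSuccLimit i) {g : Ordinal.{u} → Submodule R M}
    (hg : Monotone g) {x : M} : x ∈ (⨆ j : Set.Iio i, g j) ↔ ∃ j < i, x ∈ g j := by
  have : Nonempty (Set.Iio i) := ⟨⟨0, hi.bot_lt⟩⟩
  rw [Submodule.mem_iSup_of_directed (fun j : Set.Iio i => g j)
    (Monotone.directed_le fun a b h => hg h)]
  simp

/-- Fewer than `κ` ordinals below the initial ordinal of a regular `κ` are bounded. -/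
theorem exists_bound_lt_ord {κ : Cardinal.{u}} (hκ : κ.IsRegular) {T : Type u} (hT : #T < κ)
    (idx : T → Ordinal.{u}) (h : ∀ t, idx t < κ.ord) : ∃ i < κ.ord, ∀ t, idx t ≤ i :=
  ⟨⨆ t, idx t, Ordinal.iSup_lt_of_lt_cof (by rwa [hκ.cof_ord]) h, Ordinal.le_iSup idx⟩

/-- A union of at most `lam` sets of cardinality at most `lam`, indexed by ordinals. -/
theorem mk_biUnion_ordinal_le {X : Type u} {lam : Cardinal.{u}} (hlam : ℵ₀ ≤ lam)
    {θ : Ordinal.{u}} (hθ : θ.card ≤ lam) (c : Ordinal.{u} → Set X)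
    (hc : ∀ i < θ, #(c i) ≤ lam) (S : Set X) (hS : ∀ x ∈ S, ∃ i < θ, x ∈ c i) : #S ≤ lam := by
  have hsub : S ⊆ ⋃ t : θ.ToType, c ((Ordinal.ToType.mk.symm t : Set.Iio θ) : Ordinal.{u}) := by
    intro x hx
    obtain ⟨i, hi, hxi⟩ := hS x hx
    refine Set.mem_iUnion.2 ⟨Ordinal.ToType.mk ⟨i, hi⟩, ?_⟩
    simpa using hxi
  refine (Cardinal.mk_le_mk_of_subset hsub).trans ((Cardinal.mk_iUnion_le _).trans ?_)
  refine (mul_le_mul' (b := lam) (d := lam) ?_ ?_).trans (Cardinal.mul_eq_self hlam).le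
  · rwa [Cardinal.mk_toType]
  · exact ciSup_le' fun t => hc _ (Ordinal.ToType.mk.symm t).2

/-! ### Cardinality bounds for modules -/

section
variable {R : Type u} [Ring R] {M N P E Q : Type u} [AddCommGroup M] [Module R M]
  [AddCommGroup N] [Module R N] [AddCommGroup P] [Module R P] [AddCommGroup E] [Module R E]
  [AddCommGroup Q] [Module R Q]

theorem mk_finsupp_le_of_le {lam : Cardinal.{u}} (hlam : ℵ₀ ≤ lam) (hR : #R ≤ lam) :
    #(lam.out →₀ R) ≤ lam := by
  rcases subsingleton_or_nontrivial R with h | h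
  · exact (Cardinal.le_one_iff_subsingleton.2 inferInstance).trans
      (Cardinal.one_le_aleph0.trans hlam)
  · have : Infinite lam.out := Cardinal.infinite_iff.2 (by simpa using hlam)
    rw [Cardinal.mk_finsupp_of_infinite]
    simpa using hR

theorem exists_surjective_finsupp {lam : Cardinal.{u}} {s : Set M} (hs : #s ≤ lam) :
    ∃ f : (lam.out →₀ R) →ₗ[R] M, LinearMap.range f = Submodule.span R s := by
  rcases s.eq_empty_or_nonempty with rfl | hne
  · exact ⟨0, by simp⟩
  · have := hne.to_subtype
    obtain ⟨e⟩ : Nonempty (s ↪ lam.out) := by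
      rw [← Cardinal.le_def, Cardinal.mk_out]; exact hs
    refine ⟨Finsupp.linearCombination R (fun t => ((Function.invFun e t : s) : M)), ?_⟩
    rw [Finsupp.range_linearCombination]
    congr 1
    ext x
    constructor
    · rintro ⟨t, rfl⟩; exact (Function.invFun e t).2
    · intro hx
      exact ⟨e ⟨x, hx⟩, by simp [Function.leftInverse_invFun e.injective _]⟩

theorem mk_span_le {lam : Cardinal.{u}} (hlam : ℵ₀ ≤ lam) (hR : #R ≤ lam) {s : Set M}
    (hs : #s ≤ lam) : #(Submodule.span R s) ≤ lam := by
  obtain ⟨f, hf⟩ := exists_surjective_finsupp (R := R) hs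
  rw [← hf]
  exact (Cardinal.mk_le_of_surjective f.surjective_rangeRestrict).trans
    (mk_finsupp_le_of_le hlam hR)

theorem mk_sup_le {lam : Cardinal.{u}} (hlam : ℵ₀ ≤ lam) (A B : Submodule R M)
    (hA : #A ≤ lam) (hB : #B ≤ lam) : #(A ⊔ B : Submodule R M) ≤ lam := by
  have : Function.Surjective (fun p : A × B => (⟨(p.1 : M) + p.2,
      Submodule.add_mem_sup p.1.2 p.2.2⟩ : (A ⊔ B : Submodule R M))) := by
    rintro ⟨x, hx⟩
    obtain ⟨a, ha, b, hb, rfl⟩ := Submodule.mem_sup.1 hx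
    exact ⟨(⟨a, ha⟩, ⟨b, hb⟩), rfl⟩
  refine (Cardinal.mk_le_of_surjective this).trans ?_
  rw [Cardinal.mk_prod, Cardinal.lift_id, Cardinal.lift_id]
  exact (mul_le_mul' hA hB).trans (Cardinal.mul_eq_self hlam).le

/-! ### Amalgamation and universal extensions -/

/-- Pushouts of a module embedding. -/
theorem exists_amalgam (j : P →ₗ[R] E) (g : P →ₗ[R] Q) (hj : Function.Injective j) :
    ∃ (X : Type u) (_ : AddCommGroup X) (_ : Module R X) (a : E →ₗ[R] X) (b : Q →ₗ[R] X),
      Function.Injective b ∧ (Function.Injective g → Function.Injective a) ∧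
      (∀ p, a (j p) = b (g p)) ∧ (∀ e q, a e = b q → ∃ p, j p = e) ∧ #X ≤ #E * #Q := by
  let K : Submodule R (E × Q) := LinearMap.range (j.prod (-g))
  refine ⟨(E × Q) ⧸ K, inferInstance, inferInstance, K.mkQ ∘ₗ LinearMap.inl R E Q,
    K.mkQ ∘ₗ LinearMap.inr R E Q, ?_, ?_, ?_, ?_, ?_⟩
  · rw [injective_iff_map_eq_zero]
    intro q hq
    have : ((0 : E), q) ∈ K := by simpa using hq
    obtain ⟨p, hp⟩ := this
    have h1 : j p = 0 := congrArg Prod.fst hp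
    have h2 : -g p = q := congrArg Prod.snd hp
    have : p = 0 := hj (by simpa using h1)
    simpa [this] using h2.symm
  · intro hg
    rw [injective_iff_map_eq_zero]
    intro e he
    have : (e, (0 : Q)) ∈ K := by simpa using he
    obtain ⟨p, hp⟩ := this
    have h1 : j p = e := congrArg Prod.fst hp
    have h2 : -g p = 0 := congrArg Prod.snd hp
    have : p = 0 := hg (by simpa using h2)
    simpa [this] using h1.symm
  · intro p
    have : ((j p, (0 : Q)) - ((0 : E), g p)) ∈ K := ⟨p, by simp⟩
    exact (Submodule.Quotient.eq K).2 this
  · intro e q h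
    have : ((e, (0 : Q)) - ((0 : E), q)) ∈ K := (Submodule.Quotient.eq K).1 h
    obtain ⟨p, hp⟩ := this
    exact ⟨p, by simpa using congrArg Prod.fst hp⟩
  · refine (Cardinal.mk_le_of_surjective K.mkQ_surjective).trans ?_
    simp

/-- `Univ lam i Q`: every extension of `P` of cardinality at most `lam` embeds over `P` into the
submodule `Q` of `M`, where `P` is mapped to `M` by `i`. -/
def Univ (lam : Cardinal.{u}) (i : P →ₗ[R] M) (Q : Submodule R M) : Prop :=
  ∀ (E : Type u) [AddCommGroup E] [Module R E], #E ≤ lam → ∀ j : P →ₗ[R] E,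
    Function.Injective j → ∃ f : E →ₗ[R] M, Function.Injective f ∧ (∀ x, f x ∈ Q) ∧
      ∀ x, f (j x) = i x

theorem Univ.mono {lam : Cardinal.{u}} {i : P →ₗ[R] M} {Q Q' : Submodule R M}
    (h : Univ lam i Q) (hQ : Q ≤ Q') : Univ lam i Q' := by
  intro E _ _ hE j hj
  obtain ⟨f, hf, hfQ, hfj⟩ := h E hE j hj
  exact ⟨f, hf, fun x => hQ (hfQ x), hfj⟩

/-- Amalgamate `E` with `P` over `N`: the pushout is a small extension of `P`, and its embedding
restricts to `E`. -/
theorem Univ.comp {lam : Cardinal.{u}} (hlam : ℵ₀ ≤ lam) {i : P →ₗ[R] M} {S : Submodule R M}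
    (h : Univ lam i S) (hP : #P ≤ lam) (g : N →ₗ[R] P) (hg : Function.Injective g) :
    Univ lam (i ∘ₗ g) S := by
  intro E _ _ hE j hj
  obtain ⟨X, _, _, a, b, hb, ha, hab, -, hX⟩ := exists_amalgam j g hj
  obtain ⟨f, hf, hfQ, hfj⟩ := h X
    (hX.trans ((mul_le_mul' hE hP).trans (Cardinal.mul_eq_self hlam).le)) b hb
  exact ⟨f ∘ₗ a, hf.comp (ha hg), fun x => hfQ _, fun x => by simp [hab, hfj]⟩

/-- Universality speaks of extensions of cardinality exactly `lam`; smaller ones are padded to `E ×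
A`. -/
theorem IsUniversalOver.univ {lam : Cardinal.{u}} (hlam : ℵ₀ ≤ lam) {A B : Submodule R M}
    (h : IsUniversalOver B A) (hA : #A = lam) : Univ lam A.subtype B := by
  intro E _ _ hE j hj
  have hcard : #(E × A) = #B := by
    rw [h.2.1, hA, Cardinal.mk_prod, Cardinal.lift_id, Cardinal.lift_id, hA]
    exact Cardinal.mul_eq_right hlam hE (Cardinal.mk_ne_zero E)
  obtain ⟨f, hf, hfj⟩ := h.2.2 (E × A) hcard (LinearMap.inl R E A ∘ₗ j)
    (LinearMap.inl_injective.comp hj)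
  exact ⟨B.subtype ∘ₗ f ∘ₗ LinearMap.inl R E A,
    B.injective_subtype.comp (hf.comp LinearMap.inl_injective), fun x => (f _).2, fun x => hfj x⟩

theorem Univ.isUniversalOver {lam : Cardinal.{u}} {A B : Submodule R M}
    (h : Univ lam A.subtype B) (hAB : A ≤ B) (hA : #A = lam) (hB : #B = lam) :
    IsUniversalOver B A := by
  refine ⟨hAB, hB.trans hA.symm, ?_⟩
  intro E _ _ hE j hj
  obtain ⟨f, hf, hfQ, hfj⟩ := h E (hE.trans hB).le j hj
  exact ⟨f.codRestrict B hfQ, fun x y hxy => hf (congrArg Subtype.val hxy), hfj⟩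

/-! ### One-generator extensions -/

/-- `OneUniv A B`: every homomorphism from a left ideal `I` to `A` extends to `R → B`, in such a
way that the preimage of `A` is `I`. -/
def OneUniv (A B : Submodule R M) : Prop :=
  ∀ (I : Ideal R) (g : I →ₗ[R] A), ∃ y ∈ B, (∀ a : I, (a : R) • y = g a) ∧
    ∀ r : R, r • y ∈ A → r ∈ I

/-- Embed the pushout of `R` and `A` over `I` into `B` over `A`; the image of `1` is the required
element. In the pushout the image of `R` meets `A` only in the image of `I`. -/
theorem Univ.oneUniv {lam : Cardinal.{u}} (hlam : ℵ₀ ≤ lam) (hR : #R ≤ lam)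
    {A B : Submodule R M} (h : Univ lam A.subtype B) (hA : #A ≤ lam) : OneUniv A B := by
  intro I g
  obtain ⟨X, _, _, a, b, hb, -, hab, hr, hX⟩ :=
    exists_amalgam (I.subtype : I →ₗ[R] R) g I.injective_subtype
  obtain ⟨f, hf, hfQ, hfj⟩ := h X
    (hX.trans ((mul_le_mul' hR hA).trans (Cardinal.mul_eq_self hlam).le)) b hb
  have key : ∀ r : R, r • f (a 1) = f (a r) := fun r => by
    rw [← map_smul, ← map_smul, smul_eq_mul, mul_one]
  refine ⟨f (a 1), hfQ _, fun x => ?_, fun r hrA => ?_⟩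
  · rw [key]
    have := hab x
    simp only [Submodule.subtype_apply] at this
    rw [this, hfj]; rfl
  · rw [key] at hrA
    have h1 : f (b ⟨_, hrA⟩) = f (a r) := hfj ⟨_, hrA⟩
    obtain ⟨p, hp⟩ := hr r _ (hf h1).symm
    rw [← hp]; exact p.2

/-- One-step extension of a partial homomorphism, given by its graph. -/
theorem OneUniv.extend_graph {A B : Submodule R M} (h : OneUniv A B) (hAB : A ≤ B)
    (G : Submodule R (N × M)) (hG : ∀ y, ((0 : N), y) ∈ G → y = 0)
    (hGA : ∀ p ∈ G, p.2 ∈ A) (x : N) :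
    ∃ y ∈ B, (∀ z, ((0 : N), z) ∈ G ⊔ Submodule.span R {(x, y)} → z = 0) ∧
      (∀ p ∈ G ⊔ Submodule.span R {(x, y)}, p.2 ∈ B) ∧
      ((∀ z, (z, (0 : M)) ∈ G → z = 0) →
        ∀ z, (z, (0 : M)) ∈ G ⊔ Submodule.span R {(x, y)} → z = 0) ∧
      (y ∈ A → ∃ z, (x, z) ∈ G) := by
  classical
  -- `I` consists of the `r` with `r • x` in the domain of `G`, and `g` below sends `r` to the value
  -- there. The preimage condition in `OneUniv` says that `r • y ∈ A` only for such `r`, which keeps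
  -- the graph injective.
  let I : Ideal R := (G.map (LinearMap.fst R N M)).comap (LinearMap.toSpanSingleton R N x)
  have hI : ∀ r, r ∈ I ↔ ∃ y, (r • x, y) ∈ G := by
    intro r
    simp [I]
  have huniq : ∀ {n y z}, (n, y) ∈ G → (n, z) ∈ G → y = z := by
    intro n y z hy hz
    have := G.sub_mem hy hz
    simp only [Prod.mk_sub_mk, sub_self] at this
    exact sub_eq_zero.1 (hG _ this)
  choose φ hφ using fun r : I => (hI r).1 r.2
  let g : I →ₗ[R] A :=
    { toFun := fun r => ⟨φ r, hGA _ (hφ r)⟩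
      map_add' := fun r s => Subtype.ext <| huniq (hφ (r + s)) (by
        have := G.add_mem (hφ r) (hφ s)
        simpa [add_smul] using this)
      map_smul' := fun t r => Subtype.ext <| huniq (hφ (t • r)) (by
        have := G.smul_mem t (hφ r)
        simpa [mul_smul] using this) }
  obtain ⟨y, hyB, hy, hyA⟩ := h I g
  have hyG : ∀ r : R, r • y ∈ A → (r • x, r • y) ∈ G := by
    intro r hr
    have := hy ⟨r, hyA r hr⟩
    have h2 := hφ ⟨r, hyA r hr⟩
    simp only [g] at this
    rw [show r • y = _ from this]
    exact h2
  have hyI : ∀ r ∈ I, (r • x, r • y) ∈ G := fun r hr => hyG r (by rw [hy ⟨r, hr⟩]; exact (g _).2)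
  have hmem : ∀ p, p ∈ G ⊔ Submodule.span R {(x, y)} ↔ ∃ q ∈ G, ∃ r : R,
      q + (r • x, r • y) = p := by
    intro p
    simp [Submodule.mem_sup, Submodule.mem_span_singleton]
  refine ⟨y, hyB, ?_, ?_, ?_, ?_⟩
  · intro z hz
    obtain ⟨q, hq, r, hqr⟩ := (hmem _).1 hz
    have h1 : q.1 + r • x = 0 := congrArg Prod.fst hqr
    have hr : r ∈ I := (hI r).2 ⟨-q.2, by
      have := G.neg_mem hq
      rwa [show r • x = -q.1 from (neg_eq_of_add_eq_zero_right h1).symm]⟩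
    refine hG z ?_
    rw [← hqr]
    exact G.add_mem hq (hyI r hr)
  · intro p hp
    obtain ⟨q, hq, r, rfl⟩ := (hmem _).1 hp
    exact B.add_mem (hAB (hGA _ hq)) (B.smul_mem r hyB)
  · intro hinj z hz
    obtain ⟨q, hq, r, hqr⟩ := (hmem _).1 hz
    have h1 : q.2 + r • y = 0 := congrArg Prod.snd hqr
    have hr : r • y ∈ A := by
      rw [show r • y = -q.2 from (neg_eq_of_add_eq_zero_right h1).symm]
      exact A.neg_mem (hGA _ hq)
    refine hinj z ?_
    rw [← hqr]
    exact G.add_mem hq (hyG r hr)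
  · intro hyA'
    exact ⟨y, by simpa using hyG 1 (by simpa using hyA')⟩

end

/-! ### Injective ambient modules and chains inside them -/

section
variable {R : Type u} [Ring R]

/-- Every module embeds in an injective module. -/
theorem exists_injective_embedding (R : Type u) [Ring R] (M : Type u) [AddCommGroup M]
    [Module R M] :
    ∃ (J : Type u) (_ : AddCommGroup J) (_ : Module R J) (_ : Module.Injective R J)
      (k : M →ₗ[R] J), Function.Injective k := by
  let X := CategoryTheory.Injective.under (ModuleCat.of R M)
  have hX : CategoryTheory.Injective X := inferInstance
  have hX' : CategoryTheory.Injective (ModuleCat.of R X) := hX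
  exact ⟨X, inferInstance, inferInstance, Module.injective_module_of_injective_object R X,
    (CategoryTheory.Injective.ι (ModuleCat.of R M)).hom,
    (ModuleCat.mono_iff_injective _).1 inferInstance⟩

/-- There is an injective module that contains a copy of every module of cardinality at most
`lam`. -/
theorem exists_injective_cogenerating (R : Type u) [Ring R] (lam : Cardinal.{u}) :
    ∃ (J : Type u) (_ : AddCommGroup J) (_ : Module R J) (_ : Module.Injective R J),
      ∀ (E : Type u) [AddCommGroup E] [Module R E], #E ≤ lam →
        ∃ e : E →ₗ[R] J, Function.Injective e := by
  classical
  -- Every module of cardinality at most `lam` is one of these quotients, so it embeds as a factor.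
  let Y := (K : Submodule R (lam.out →₀ R)) → (lam.out →₀ R) ⧸ K
  let _ : AddCommGroup Y := inferInstance
  let _ : Module R Y := inferInstance
  obtain ⟨J, _, _, hJ, k, hk⟩ := exists_injective_embedding R Y
  refine ⟨J, inferInstance, inferInstance, hJ, ?_⟩
  intro E _ _ hE
  obtain ⟨f, hf⟩ := exists_surjective_finsupp (R := R) (M := E) (s := Set.univ)
    (lam := lam) (by simpa using hE)
  rw [Submodule.span_univ] at hf
  let q : ((lam.out →₀ R) ⧸ LinearMap.ker f) ≃ₗ[R] E :=
    f.quotKerEquivOfSurjective (LinearMap.range_eq_top.1 hf)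
  refine ⟨k ∘ₗ LinearMap.single R (fun K : Submodule R (lam.out →₀ R) => (lam.out →₀ R) ⧸ K) (LinearMap.ker f) ∘ₗ
    q.symm.toLinearMap, ?_⟩
  exact hk.comp ((Pi.single_injective (M := fun K : Submodule R (lam.out →₀ R) => (lam.out →₀ R) ⧸ K)
    (LinearMap.ker f)).comp q.symm.injective)

/-- A total functional graph is the graph of a linear map. -/
theorem exists_linearMap_of_graph {N M : Type*} [AddCommGroup N] [Module R N] [AddCommGroup M]
    [Module R M] (G : Submodule R (N × M)) (hG : ∀ y, ((0 : N), y) ∈ G → y = 0)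
    (ht : ∀ x, ∃ y, (x, y) ∈ G) : ∃ f : N →ₗ[R] M, ∀ x, (x, f x) ∈ G := by
  have huniq : ∀ {n y z}, (n, y) ∈ G → (n, z) ∈ G → y = z := by
    intro n y z hy hz
    have := G.sub_mem hy hz
    simp only [Prod.mk_sub_mk, sub_self] at this
    exact sub_eq_zero.1 (hG _ this)
  choose φ hφ using ht
  exact ⟨{ toFun := φ
           map_add' := fun x y => huniq (hφ _) (G.add_mem (hφ x) (hφ y))
           map_smul' := fun r x => huniq (hφ _) (G.smul_mem r (hφ x)) }, hφ⟩

/-- If every module `P` of cardinality at most `lam` has an extension of cardinality at most `lam`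
with a given invariant property, then there are continuous chains of such extensions. -/
theorem exists_chain_of_extension {lam : Cardinal.{u}} (hlam : ℵ₀ ≤ lam)
    (Ψ : ∀ (M : Type u) [AddCommGroup M] [Module R M], Submodule R M → Submodule R M → Prop)
    (hΨ : ∀ (M W : Type u) [AddCommGroup M] [Module R M] [AddCommGroup W] [Module R W]
      (A B : Submodule R M) (f : M →ₗ[R] W), Function.Injective f → A ≤ B → Ψ M A B →
        Ψ W (A.map f) (B.map f))
    (H : ∀ (P : Type u) [AddCommGroup P] [Module R P], #P ≤ lam →
      ∃ (Q : Type u) (_ : AddCommGroup Q) (_ : Module R Q) (i : P →ₗ[R] Q),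
        Function.Injective i ∧ #Q ≤ lam ∧ Ψ Q (LinearMap.range i) ⊤)
    (θ : Ordinal.{u}) (hθ : θ.card ≤ lam)
    (P₀ : Type u) [AddCommGroup P₀] [Module R P₀] (hP₀ : #P₀ ≤ lam) :
    ∃ (W : Type u) (_ : AddCommGroup W) (_ : Module R W) (c : Ordinal.{u} → Submodule R W)
      (i₀ : P₀ →ₗ[R] W), Function.Injective i₀ ∧ c 0 = LinearMap.range i₀ ∧ Monotone c ∧
      (∀ i ≤ θ, #(c i) ≤ lam) ∧ (∀ i < θ, Ψ W (c i) (c (Order.succ i))) ∧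
      ∀ i, Order.IsSuccLimit i → c i = ⨆ j : Set.Iio i, c j := by
  classical
  obtain ⟨J, _, _, _, hJ⟩ := exists_injective_cogenerating R lam
  -- The chain lives in the injective module `T → J`, so unions replace direct limits. Coordinate
  -- `0` holds `P₀`; stage `i` is supported below `1 + i`, leaving coordinate `1 + i` fresh for the
  -- next extension.
  let T := (1 + θ).ToType
  let pos : T → Ordinal.{u} := fun t => (Ordinal.ToType.mk.symm t : Set.Iio (1 + θ))
  have hpos : ∀ i < 1 + θ, ∃ t, pos t = i := fun i hi =>
    ⟨Ordinal.ToType.mk ⟨i, hi⟩, by simp [pos]⟩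
  let S : Ordinal.{u} → Submodule R (T → J) := fun i =>
    { carrier := {w | ∀ t, 1 + i ≤ pos t → w t = 0}
      add_mem' := fun {v w} hv hw t ht => by simp [hv t ht, hw t ht]
      zero_mem' := fun t _ => rfl
      smul_mem' := fun r w hw t ht => by simp [hw t ht] }
  have hS : Monotone S := fun i j hij w hw t ht => hw t ((by gcongr : 1 + i ≤ 1 + j).trans ht)
  have step : ∀ i < θ, ∀ A : Submodule R (T → J), A ≤ S i ∧ #A ≤ lam →
      ∃ B, A ≤ B ∧ (B ≤ S (Order.succ i) ∧ #B ≤ lam) ∧ Ψ (T → J) A B := by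
    rintro i hi A ⟨hAS, hA⟩
    obtain ⟨Q, _, _, ι, hι, hQ, hΨQ⟩ := H A hA
    obtain ⟨h, hh⟩ := Module.Injective.extension_property R (T → J) A Q ι hι A.subtype
    have hh' : ∀ a : A, h (ι a) = a := fun a => LinearMap.congr_fun hh a
    obtain ⟨e, he⟩ := hJ (Q ⧸ LinearMap.range ι)
      ((Cardinal.mk_le_of_surjective (LinearMap.range ι).mkQ_surjective).trans hQ)
    -- The old coordinates extend the inclusion of `A`; the fresh one is an embedding of `Q / A`. An
    -- element of the kernel therefore lies in `A`, where `f` is the inclusion.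
    let f : Q →ₗ[R] (T → J) := LinearMap.pi fun t =>
      if pos t < 1 + i then LinearMap.proj t ∘ₗ h
      else if pos t = 1 + i then e ∘ₗ (LinearMap.range ι).mkQ else 0
    have f1 : ∀ q t, pos t < 1 + i → f q t = h q t := fun q t ht => by simp [f, ht]
    have f2 : ∀ q t, pos t = 1 + i → f q t = e ((LinearMap.range ι).mkQ q) :=
      fun q t ht => by simp [f, ht]
    have f3 : ∀ q t, 1 + i < pos t → f q t = 0 :=
      fun q t ht => by simp [f, ht.not_gt, ht.ne']
    have fι : ∀ a : A, f (ι a) = a := by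
      intro a
      ext t
      rcases lt_trichotomy (pos t) (1 + i) with ht | ht | ht
      · rw [f1 _ _ ht, hh']
      · rw [f2 _ _ ht, hAS a.2 t ht.ge]
        have : (LinearMap.range ι).mkQ (ι a) = 0 := by simp
        rw [this, map_zero]
      · rw [f3 _ _ ht, hAS a.2 t ht.le]
    obtain ⟨t₀, ht₀⟩ := hpos (1 + i) (by gcongr)
    have hf : Function.Injective f := by
      rw [injective_iff_map_eq_zero]
      intro q hq
      have h1 : e ((LinearMap.range ι).mkQ q) = 0 := by rw [← f2 q t₀ ht₀, hq]; rfl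
      have h2 : (LinearMap.range ι).mkQ q = 0 := he (by rw [h1, map_zero])
      obtain ⟨a, rfl⟩ : q ∈ LinearMap.range ι := by simpa using h2
      have : a = 0 := Subtype.ext (by rw [← fι a, hq]; rfl)
      rw [this, map_zero]
    have hmap : (LinearMap.range ι).map f = A := by
      ext x
      constructor
      · rintro ⟨_, ⟨a, rfl⟩, rfl⟩
        rw [fι]; exact a.2
      · intro hx
        exact ⟨_, ⟨⟨x, hx⟩, rfl⟩, fι ⟨x, hx⟩⟩
    refine ⟨(⊤ : Submodule R Q).map f, ?_, ⟨?_, ?_⟩, ?_⟩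
    · conv_lhs => rw [← hmap]
      exact Submodule.map_mono le_top
    · rintro _ ⟨q, -, rfl⟩ t ht
      refine f3 q t (lt_of_lt_of_le ?_ ht)
      gcongr
      exact Order.lt_succ i
    · rw [Submodule.map_top]
      exact (Cardinal.mk_le_of_surjective f.surjective_rangeRestrict).trans hQ
    · have := hΨ Q (T → J) _ _ f hf le_top hΨQ
      rwa [hmap] at this
  obtain ⟨e₀, he₀⟩ := hJ P₀ hP₀
  obtain ⟨t₀, ht₀⟩ := hpos 0 (zero_lt_one.trans_le le_self_add)
  let i₀ : P₀ →ₗ[R] (T → J) := LinearMap.single R (fun _ : T => J) t₀ ∘ₗ e₀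
  have hi₀ : Function.Injective i₀ := (Pi.single_injective (M := fun _ : T => J) t₀).comp he₀
  obtain ⟨c, c0, cm, cP, cS, cl⟩ := exists_transfinite_chain θ
    (fun i A => A ≤ S i ∧ #A ≤ lam) (fun _ A B => Ψ (T → J) A B) (LinearMap.range i₀)
    (by
      refine ⟨?_, (Cardinal.mk_le_of_surjective i₀.surjective_rangeRestrict).trans hP₀⟩
      rintro _ ⟨p, rfl⟩ t ht
      have : t ≠ t₀ := by rintro rfl; rw [ht₀] at ht; simp at ht
      simp [i₀, this])
    step
    (by
      intro i hi hlim g hg hP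
      refine ⟨iSup_le fun j => (hP j j.2).1.trans (hS (le_of_lt j.2)), ?_⟩
      refine mk_biUnion_ordinal_le hlam ((Ordinal.card_le_card hi).trans hθ)
        (fun j => (g j : Set (T → J))) (fun j hj => (hP j hj).2) _ ?_
      intro x hx
      exact (Submodule.mem_iSup_Iio hlim hg).1 hx)
  exact ⟨T → J, inferInstance, inferInstance, c, i₀, hi₀, c0, cm, fun i hi => (cP i hi).2, cS, cl⟩

theorem OneUniv.map {M W : Type u} [AddCommGroup M] [Module R M] [AddCommGroup W] [Module R W]
    {A B : Submodule R M} (h : OneUniv A B) (f : M →ₗ[R] W) (hf : Function.Injective f) :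
    OneUniv (A.map f) (B.map f) := by
  intro I g
  let e := Submodule.equivMapOfInjective f hf A
  obtain ⟨y, hy, hyI, hyA⟩ := h I (e.symm.toLinearMap ∘ₗ g)
  refine ⟨f y, ⟨y, hy, rfl⟩, fun a => ?_, fun r hr => hyA r ?_⟩
  · rw [← map_smul, hyI]
    have : (e (e.symm (g a)) : W) = g a := by rw [e.apply_symm_apply]
    exact this
  · rw [← map_smul] at hr
    obtain ⟨x, hx, hxy⟩ := hr
    rwa [← hf hxy]

theorem Univ.map {M W : Type u} [AddCommGroup M] [Module R M] [AddCommGroup W] [Module R W]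
    {lam : Cardinal.{u}} {A B : Submodule R M} (h : Univ lam A.subtype B) (f : M →ₗ[R] W)
    (hf : Function.Injective f) : Univ lam (A.map f).subtype (B.map f) := by
  intro E _ _ hE j hj
  let e := Submodule.equivMapOfInjective f hf A
  obtain ⟨k, hk, hkB, hkj⟩ := h E hE (j ∘ₗ e.toLinearMap) (hj.comp e.injective)
  refine ⟨f ∘ₗ k, hf.comp hk, fun x => ⟨_, hkB x, rfl⟩, fun x => ?_⟩
  obtain ⟨a, rfl⟩ := e.surjective x
  have := hkj a
  simp only [LinearMap.comp_apply, LinearEquiv.coe_coe, Submodule.subtype_apply] at this ⊢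
  rw [this]
  rfl

/-! ### Existence of universal extensions -/

/-- Every module of cardinality at most `lam` has a universal extension of cardinality at most
`lam`. -/
def HasUniversalExtensions (R : Type u) [Ring R] (lam : Cardinal.{u}) : Prop :=
  ∀ (P : Type u) [AddCommGroup P] [Module R P], #P ≤ lam →
    ∃ (Q : Type u) (_ : AddCommGroup Q) (_ : Module R Q) (i : P →ₗ[R] Q),
      Function.Injective i ∧ #Q ≤ lam ∧ Univ lam i ⊤

/-- An extension of `P` that realizes all homomorphisms from left ideals to `P`. -/
theorem exists_oneUniv_extension {lam : Cardinal.{u}} (hlam : ℵ₀ ≤ lam) (hR : 2 ^ #R ≤ lam)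
    (hpow : lam ^ #R ≤ lam) (P : Type u) [AddCommGroup P] [Module R P] (hP : #P ≤ lam) :
    ∃ (Q : Type u) (_ : AddCommGroup Q) (_ : Module R Q) (i : P →ₗ[R] Q),
      Function.Injective i ∧ #Q ≤ lam ∧ OneUniv (LinearMap.range i) ⊤ := by
  classical
  obtain ⟨J, _, _, _, k, hk⟩ := exists_injective_embedding R P
  -- The `J`-component solves the equations prescribed by `d`. The component `1` in `R ⧸ I` vanishes
  -- on multiplying by `r` exactly when `r ∈ I`, so no further multiples fall into `P`.
  let X := J × ((I : Ideal R) → R ⧸ I)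
  let i : P →ₗ[R] X := k.prod 0
  have hi : Function.Injective i := fun a b h => hk (congrArg Prod.fst h)
  let D := Σ I : Ideal R, (I →ₗ[R] P)
  have hsol : ∀ d : D, ∃ s : J, ∀ a : d.1, (a : R) • s = k (d.2 a) := by
    intro d
    obtain ⟨h, hh⟩ := Module.Injective.extension_property R J d.1 R d.1.subtype
      d.1.injective_subtype (k ∘ₗ d.2)
    refine ⟨h 1, fun a => ?_⟩
    rw [← map_smul, smul_eq_mul, mul_one]
    exact LinearMap.congr_fun hh a
  choose sol hsol using hsol
  let y : D → X := fun d => (sol d, Pi.single d.1 (d.1.mkQ 1))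
  let B : Submodule R X := LinearMap.range i ⊔ Submodule.span R (Set.range y)
  -- There are at most `2 ^ #R` ideals, and a homomorphism to `P`, extended by `0`, is one of at
  -- most `lam ^ #R` functions.
  have hD : #D ≤ lam := by
    let φ : D → Set R × (R → P) := fun d =>
      ((d.1 : Set R), fun r => if h : r ∈ d.1 then d.2 ⟨r, h⟩ else 0)
    have hφ : Function.Injective φ := by
      rintro ⟨I, f⟩ ⟨I', f'⟩ h
      have h1 : I = I' := SetLike.coe_injective (congrArg Prod.fst h)
      subst h1
      have h2 := congrArg Prod.snd h
      congr 1
      ext r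
      simpa [φ] using congrFun h2 r
    refine (Cardinal.mk_le_of_injective hφ).trans ?_
    rw [Cardinal.mk_prod, Cardinal.lift_id, Cardinal.lift_id, Cardinal.mk_set,
      ← Cardinal.power_def]
    exact (mul_le_mul' hR ((Cardinal.power_le_power_right hP).trans hpow)).trans
      (Cardinal.mul_eq_self hlam).le
  have hB : #B ≤ lam := mk_sup_le hlam _ _
    ((Cardinal.mk_le_of_surjective i.surjective_rangeRestrict).trans hP)
    (mk_span_le hlam ((Cardinal.cantor _).le.trans hR) (Cardinal.mk_range_le.trans hD))
  have hiB : ∀ p, i p ∈ B := fun p => Submodule.mem_sup_left ⟨p, rfl⟩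
  refine ⟨B, inferInstance, inferInstance, i.codRestrict B hiB,
    fun a b h => hi (congrArg Subtype.val h), hB, ?_⟩
  intro I g
  have hinj : Function.Injective (i.codRestrict B hiB) :=
    fun a b h => hi (congrArg Subtype.val h)
  let e := LinearEquiv.ofInjective _ hinj
  let d : D := ⟨I, e.symm.toLinearMap ∘ₗ g⟩
  refine ⟨⟨y d, Submodule.mem_sup_right (Submodule.subset_span ⟨d, rfl⟩)⟩, trivial, ?_, ?_⟩
  · intro a
    have h1 : (e (e.symm (g a)) : B) = g a := by rw [e.apply_symm_apply]
    rw [← h1]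
    refine Subtype.ext (Prod.ext (hsol d a) ?_)
    change (a : R) • (Pi.single I (I.mkQ 1) : (I : Ideal R) → R ⧸ I) = 0
    rw [← Pi.single_smul, ← map_smul, smul_eq_mul, mul_one]
    have : I.mkQ (a : R) = 0 := by simp
    rw [this, Pi.single_zero]
  · rintro r ⟨p, hp⟩
    have h1 : (0 : (I : Ideal R) → R ⧸ I) = r • Pi.single I (I.mkQ 1) :=
      congrArg (fun x : B => (x : X).2) hp
    rw [← Pi.single_smul, ← map_smul, smul_eq_mul, mul_one] at h1
    have h2 := congrFun h1 I
    rw [Pi.single_eq_same] at h2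
    simpa using h2.symm

/-- Iterate the one-generator construction `lam` times. Given an extension `E`, list its elements in
type `lam.ord` and adjoin the `i`-th to the domain of a partial embedding at step `i`, with values
in the next term of the chain. -/
theorem hasUniversalExtensions_of_power {lam : Cardinal.{u}} (hlam : ℵ₀ ≤ lam)
    (hR : 2 ^ #R ≤ lam) (hpow : lam ^ #R ≤ lam) : HasUniversalExtensions R lam := by
  classical
  intro P _ _ hP
  obtain ⟨W, _, _, c, i₀, hi₀, c0, cm, cc, cS, cl⟩ := exists_chain_of_extension hlam
    (fun M _ _ A B => OneUniv A B) (fun M W _ _ _ _ A B f hf _ h => h.map f hf)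
    (fun P _ _ hP => exists_oneUniv_extension hlam hR hpow P hP) lam.ord (by simp) P hP
  have hi₀c : ∀ i p, i₀ p ∈ c i := fun i p => cm (zero_le) (by rw [c0]; exact ⟨p, rfl⟩)
  refine ⟨c lam.ord, inferInstance, inferInstance, i₀.codRestrict _ (hi₀c _),
    fun a b h => hi₀ (congrArg Subtype.val h), cc _ le_rfl, ?_⟩
  intro E _ _ hE j hj
  obtain ⟨ε⟩ : Nonempty (E ↪ lam.ord.ToType) := by
    rw [← Cardinal.le_def, Cardinal.mk_ord_toType]; exact hE
  -- Repetitions are allowed, since `E` may have fewer than `lam` elements.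
  let e : Ordinal.{u} → E := fun i =>
    if h : i < lam.ord then Function.invFun ε (Ordinal.ToType.mk ⟨i, h⟩) else 0
  have he : ∀ x, ∃ i < lam.ord, e i = x := by
    intro x
    have hlt : ((Ordinal.ToType.mk.symm (ε x) : Set.Iio lam.ord) : Ordinal.{u}) < lam.ord :=
      (Ordinal.ToType.mk.symm (ε x)).2
    refine ⟨_, hlt, ?_⟩
    simp only [e, dif_pos hlt]
    exact (congrArg (Function.invFun ε) (Ordinal.ToType.mk.apply_symm_apply (ε x))).trans
      (Function.leftInverse_invFun ε.injective x)
  obtain ⟨G, G0, Gm, GP, GS, -⟩ := exists_transfinite_chain lam.ord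
    (fun i (G : Submodule R (E × W)) => (∀ y, ((0 : E), y) ∈ G → y = 0) ∧
      (∀ p ∈ G, p.2 ∈ c i) ∧ ∀ z, (z, (0 : W)) ∈ G → z = 0)
    (fun i _ G => ∃ y, (e i, y) ∈ G) (LinearMap.range (j.prod i₀))
    (by
      refine ⟨?_, ?_, ?_⟩
      · rintro y ⟨p, hp⟩
        have h1 : j p = 0 := congrArg Prod.fst hp
        have h2 : i₀ p = y := congrArg Prod.snd hp
        rw [← h2, hj (h1.trans (map_zero j).symm), map_zero]
      · rintro _ ⟨p, rfl⟩
        exact hi₀c 0 p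
      · rintro z ⟨p, hp⟩
        have h1 : j p = z := congrArg Prod.fst hp
        have h2 : i₀ p = 0 := congrArg Prod.snd hp
        rw [← h1, hi₀ (h2.trans (map_zero i₀).symm), map_zero])
    (by
      rintro i hi G ⟨h1, h2, h3⟩
      obtain ⟨y, -, k1, k2, k3, -⟩ :=
        (cS i hi).extend_graph (cm (Order.le_succ i)) G h1 h2 (e i)
      exact ⟨_, le_sup_left, ⟨k1, k2, k3 h3⟩, y,
        Submodule.mem_sup_right (Submodule.mem_span_singleton_self _)⟩)
    (by
      intro i hi hlim g hg hP
      refine ⟨fun y hy => ?_, fun p hp => ?_, fun z hz => ?_⟩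
      · obtain ⟨j, hj, h⟩ := (Submodule.mem_iSup_Iio hlim hg).1 hy
        exact (hP j hj).1 y h
      · obtain ⟨j, hj, h⟩ := (Submodule.mem_iSup_Iio hlim hg).1 hp
        exact cm hj.le ((hP j hj).2.1 p h)
      · obtain ⟨j, hj, h⟩ := (Submodule.mem_iSup_Iio hlim hg).1 hz
        exact (hP j hj).2.2 z h)
  obtain ⟨h1, h2, h3⟩ := GP lam.ord le_rfl
  obtain ⟨f, hf⟩ := exists_linearMap_of_graph (G lam.ord) h1 (by
    intro x
    obtain ⟨i, hi, rfl⟩ := he x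
    obtain ⟨y, hy⟩ := GS i hi
    exact ⟨y, Gm (Order.succ_le_of_lt hi) hy⟩)
  refine ⟨f.codRestrict _ fun x => h2 _ (hf x), ?_, fun _ => trivial, fun p => Subtype.ext ?_⟩
  · rw [injective_iff_map_eq_zero]
    intro x hx
    refine h3 x ?_
    have : f x = 0 := congrArg Subtype.val hx
    rw [← this]; exact hf x
  · have h4 : (j p, i₀ p) ∈ G lam.ord := Gm (zero_le) (by rw [G0]; exact ⟨p, rfl⟩)
    have h5 := (G lam.ord).sub_mem (hf (j p)) h4
    simp only [Prod.mk_sub_mk, sub_self] at h5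
    exact sub_eq_zero.1 (h1 _ h5)

end

/-! ### Chains of universal extensions and limit models -/

section
variable {R : Type u} [Ring R] {M N P : Type u} [AddCommGroup M] [Module R M]
  [AddCommGroup N] [Module R N] [AddCommGroup P] [Module R P]

/-- `c` restricted to the ordinals below `κ.ord` is an increasing chain of submodules of cardinality
at most `lam` with union `M`, each term of which is universal over the previous ones. -/
structure IsUnivChain (lam κ : Cardinal.{u}) (c : Ordinal.{u} → Submodule R M) : Prop where
  card_le : ∀ i < κ.ord, #(c i) ≤ lam
  mono : ∀ i j, i ≤ j → j < κ.ord → c i ≤ c j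
  union : ∀ x : M, ∃ i < κ.ord, x ∈ c i
  univ : ∀ i < κ.ord, Univ lam (c i).subtype (c (Order.succ i))

theorem Univ.codRestrict {lam : Cardinal.{u}} {i : P →ₗ[R] M} {B : Submodule R M}
    (h : Univ lam i B) (hi : ∀ p, i p ∈ B) : Univ lam (i.codRestrict B hi) ⊤ := by
  intro E _ _ hE j hj
  obtain ⟨f, hf, hfB, hfj⟩ := h E hE j hj
  exact ⟨f.codRestrict B hfB, fun a b hab => hf (congrArg Subtype.val hab), fun _ => trivial,
    fun x => Subtype.ext (hfj x)⟩

/-- Embedding `P × c 0` over `c 0` puts a copy of `P` in the next term `c 1`; then `c 2`, universal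
over `c 1`, is universal over that copy by `Univ.comp`. -/
theorem IsStableIn.hasUniversalExtensions {lam : Cardinal.{u}} (h : IsStableIn R lam) :
    HasUniversalExtensions R lam := by
  obtain ⟨M, α, N, hlam, hα, -, c, hc⟩ := h
  intro P _ _ hP
  have h0 : 0 < α := hα.bot_lt
  have h1 : Order.succ 0 < α := hα.succ_lt h0
  have hcard : #(P × c 0) ≤ lam := by
    rw [Cardinal.mk_prod, Cardinal.lift_id, Cardinal.lift_id, hc.card_eq 0 h0]
    exact (mul_le_mul' hP le_rfl).trans (Cardinal.mul_eq_self hlam).le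
  obtain ⟨f, hf, hf1, -⟩ := (hc.universal 0 h0).univ hlam (hc.card_eq 0 h0) (P × c 0) hcard
    (LinearMap.inr R P (c 0)) LinearMap.inr_injective
  let p : P →ₗ[R] c (Order.succ 0) := (f ∘ₗ LinearMap.inl R P (c 0)).codRestrict _
    fun x => hf1 _
  have hp : Function.Injective p :=
    fun a b hab => LinearMap.inl_injective (R := R) (M₂ := c 0) (hf (congrArg Subtype.val hab))
  have hu := ((hc.universal _ h1).univ hlam (hc.card_eq _ h1)).comp hlam
    (hc.card_eq _ h1).le p hp
  have hmem : ∀ x, ((c (Order.succ 0)).subtype ∘ₗ p) x ∈ c (Order.succ (Order.succ 0)) :=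
    fun x => (hc.universal _ h1).1 (p x).2
  exact ⟨c (Order.succ (Order.succ 0)), inferInstance, inferInstance, _,
    fun a b hab => hp (Subtype.ext (congrArg (fun x : c (Order.succ (Order.succ 0)) => (x : M)) hab)), (hc.card_eq _ (hα.succ_lt h1)).le,
    hu.codRestrict hmem⟩

theorem mk_finsupp_out [Nontrivial R] {lam : Cardinal.{u}} (hlam : ℵ₀ ≤ lam) (hR : #R ≤ lam) :
    #(lam.out →₀ R) = lam := by
  have : Infinite lam.out := Cardinal.infinite_iff.2 (by simpa using hlam)
  rw [Cardinal.mk_finsupp_of_infinite]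
  simpa using hR

/-- Existence of limit models of every length. -/
theorem HasUniversalExtensions.exists_isLimitModelOver [Nontrivial R] {lam : Cardinal.{u}}
    (h : HasUniversalExtensions R lam) (hlam : ℵ₀ ≤ lam) (hR : #R ≤ lam) {θ : Ordinal.{u}}
    (hθ : Order.IsSuccLimit θ) (hθ' : θ < (Order.succ lam).ord) :
    ∃ (M : ModuleCat.{u} R) (N : Submodule R M), IsLimitModelOver lam θ N := by
  have hθc : θ.card ≤ lam := Order.lt_succ_iff.1 (Cardinal.lt_ord.1 hθ')
  -- Starting from a free module of rank `lam` makes every term have cardinality exactly `lam`.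
  have hP₀ := mk_finsupp_out (R := R) hlam hR
  obtain ⟨W, _, _, c, i₀, hi₀, c0, cm, cc, cS, cl⟩ := exists_chain_of_extension (R := R) hlam
    (fun M _ _ A B => A ≤ B ∧ Univ lam A.subtype B)
    (fun M W _ _ _ _ A B f hf _ h => ⟨Submodule.map_mono h.1, h.2.map f hf⟩)
    (fun P _ _ hP => by
      obtain ⟨Q, _, _, i, hi, hQ, hu⟩ := h P hP
      refine ⟨Q, inferInstance, inferInstance, i, hi, hQ, le_top, ?_⟩
      let e := LinearEquiv.ofInjective i hi
      have := hu.comp hlam hP e.symm.toLinearMap e.symm.injective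
      convert this using 1
      ext x
      exact (congrArg Subtype.val (e.apply_symm_apply x)).symm)
    θ hθc (lam.out →₀ R) hP₀.le
  have hcard : ∀ i ≤ θ, #(c i) = lam := by
    intro i hi
    refine le_antisymm (cc i hi) ?_
    calc lam = #(LinearMap.range i₀) := by
          exact hP₀.symm.trans (LinearEquiv.ofInjective i₀ hi₀).toEquiv.cardinal_eq
      _ = #(c 0) := by rw [c0]
      _ ≤ #(c i) := Cardinal.mk_le_mk_of_subset (cm zero_le)
  let e : ∀ i ≤ θ, (c i).comap (c θ).subtype ≃ₗ[R] c i := fun i hi =>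
    Submodule.comapSubtypeEquivOfLe (cm hi)
  have hcard' : ∀ i ≤ θ, #((c i).comap (c θ).subtype) = lam := fun i hi =>
    (e i hi).toEquiv.cardinal_eq.trans (hcard i hi)
  refine ⟨ModuleCat.of R (c θ), (c 0).comap (c θ).subtype, hlam, hθ, hθ',
    fun i => (c i).comap (c θ).subtype, ?_⟩
  refine ⟨fun i hi => hcard' i hi.le, fun i j hij _ => Submodule.comap_mono (cm hij), ?_, rfl,
    ?_, ?_⟩
  · intro i hi hlim
    ext x
    have := Submodule.mem_iSup_Iio (R := R) hlim cm (x := (x : W))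
    rw [← cl i hlim] at this
    simpa using this
  · ext x
    have := Submodule.mem_iSup_Iio (R := R) hθ cm (x := (x : W))
    rw [← cl θ hθ] at this
    simpa using this.1 x.2
  · intro i hi
    have hi' := Order.succ_le_of_lt hi
    refine Univ.isUniversalOver (lam := lam) ?_ (Submodule.comap_mono (cm (Order.le_succ i)))
      (hcard' i hi.le) (hcard' _ hi')
    intro E _ _ hE j hj
    obtain ⟨f, hf, hfB, hfj⟩ := (cS i hi).2 E hE (j ∘ₗ (e i hi.le).symm.toLinearMap)
      (hj.comp (e i hi.le).symm.injective)
    refine ⟨f.codRestrict (c θ) fun x => cm hi' (hfB x),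
      fun a b hab => hf (congrArg Subtype.val hab), hfB, fun x => Subtype.ext ?_⟩
    have := hfj (e i hi.le x)
    simp only [LinearMap.comp_apply, LinearEquiv.coe_coe, LinearEquiv.symm_apply_apply] at this
    exact this

/-- A limit model has a chain whose length is a regular cardinal. -/
theorem IsLimitModelOver.exists_isUnivChain {lam : Cardinal.{u}} {α : Ordinal.{u}}
    {A : Submodule R M} (h : IsLimitModelOver lam α A) :
    ∃ c : Ordinal.{u} → Submodule R M, IsUnivChain lam α.cof c := by
  obtain ⟨hlam, hα, -, c, hc⟩ := h
  obtain ⟨f, hf⟩ := Ordinal.exists_isFundamentalSeq (o := α) rfl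
  have hreg := Cardinal.isRegular_cof hα
  have hlim := Cardinal.isSuccLimit_ord hreg.aleph0_le
  -- Passing to a cofinal subsequence may lose continuity, which `IsUnivChain` does not ask for. The
  -- value `⊤` is never used.
  let d : Ordinal.{u} → Submodule R M := fun i =>
    if h : i < α.cof.ord then c (f ⟨i, h⟩) else ⊤
  have hd : ∀ i (h : i < α.cof.ord), d i = c (f ⟨i, h⟩) := fun i h => by simp [d, h]
  have hfα : ∀ i, ((f i : Set.Iio α) : Ordinal.{u}) < α := fun i => (f i).2
  refine ⟨d, ?_, ?_, ?_, ?_⟩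
  · intro i hi
    rw [hd i hi]; exact (hc.card_eq _ (hfα _)).le
  · intro i j hij hj
    rw [hd i (hij.trans_lt hj), hd j hj]
    exact hc.mono _ _ (hf.strictMono.monotone (show (⟨i, _⟩ : Set.Iio _) ≤ ⟨j, _⟩ from hij))
      (hfα _)
  · intro x
    have hx : x ∈ ⋃ i < α, (c i : Set M) := by rw [hc.union]; trivial
    simp only [Set.mem_iUnion] at hx
    obtain ⟨i, hi, hx⟩ := hx
    obtain ⟨_, ⟨j, rfl⟩, hj⟩ := hf.isCofinal_range ⟨i, hi⟩
    refine ⟨j, j.2, ?_⟩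
    rw [hd j j.2]
    exact hc.mono _ _ hj (hfα _) hx
  · intro i hi
    have hi' : Order.succ i < α.cof.ord := hlim.succ_lt hi
    rw [hd i hi, hd _ hi']
    refine ((hc.universal _ (hfα _)).univ hlam (hc.card_eq _ (hfα _))).mono
      (hc.mono _ _ (Order.succ_le_of_lt ?_) (hfα _))
    exact hf.strictMono (show (⟨i, hi⟩ : Set.Iio _) < ⟨_, hi'⟩ from Order.lt_succ i)

/-- Back-and-forth: chains of the same length have isomorphic unions. -/
theorem IsUnivChain.nonempty_linearEquiv {lam κ : Cardinal.{u}} (hlam : ℵ₀ ≤ lam) (hκ : ℵ₀ ≤ κ)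
    {c : Ordinal.{u} → Submodule R M} {d : Ordinal.{u} → Submodule R N}
    (hc : IsUnivChain lam κ c) (hd : IsUnivChain lam κ d) : Nonempty (M ≃ₗ[R] N) := by
  have hlim := Cardinal.isSuccLimit_ord hκ
  obtain ⟨G, G0, Gm, GP, GS, -⟩ := exists_transfinite_chain κ.ord
    -- `G` is the graph of a partial isomorphism. It is confined to `c i` and `d i` only for `i <
    -- κ.ord`, since the chains carry no information at `κ.ord`.
    (fun i (G : Submodule R (M × N)) => (∀ y, ((0 : M), y) ∈ G → y = 0) ∧
      (∀ x, (x, (0 : N)) ∈ G → x = 0) ∧ (i < κ.ord → ∀ p ∈ G, p.1 ∈ c i ∧ p.2 ∈ d i))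
    (fun i _ G => (∀ x ∈ c i, ∃ y, (x, y) ∈ G) ∧ ∀ y ∈ d i, ∃ x, (x, y) ∈ G) ⊥
    (by simp)
    (by
      rintro i hi G ⟨h1, h2, h3⟩
      have hi' := hlim.succ_lt hi
      let p₁ : G →ₗ[R] c i :=
        (LinearMap.fst R M N ∘ₗ G.subtype).codRestrict _ fun p => (h3 hi p p.2).1
      let p₂ : G →ₗ[R] d i :=
        (LinearMap.snd R M N ∘ₗ G.subtype).codRestrict _ fun p => (h3 hi p p.2).2
      have hp₁ : Function.Injective p₁ := by
        rw [injective_iff_map_eq_zero]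
        rintro ⟨⟨x, y⟩, hxy⟩ h
        have hx : x = 0 := congrArg Subtype.val h
        subst hx
        exact Subtype.ext (Prod.ext rfl (h1 y hxy))
      have hp₂ : Function.Injective p₂ := by
        rw [injective_iff_map_eq_zero]
        rintro ⟨⟨x, y⟩, hxy⟩ h
        have hy : y = 0 := congrArg Subtype.val h
        subst hy
        exact Subtype.ext (Prod.ext (h2 x hxy) rfl)
      -- Forth: `f` embeds `c i` in the next term of `d`, extending `G`. Back: `g` below embeds `E`,
      -- generated by the image of `f` and `d i`, in the next term of `c`, inverting `f`. The new
      -- graph is that of `g`, read backwards.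
      obtain ⟨f, hf, hfd, hfp⟩ := (hd.univ i hi).comp hlam (hd.card_le i hi) p₂ hp₂ (c i)
        (hc.card_le i hi) p₁ hp₁
      let E := LinearMap.range f ⊔ d i
      have hE : #E ≤ lam := mk_sup_le hlam _ _
        ((Cardinal.mk_le_of_surjective f.surjective_rangeRestrict).trans (hc.card_le i hi))
        (hd.card_le i hi)
      have hEd : E ≤ d (Order.succ i) := by
        refine sup_le ?_ (hd.mono _ _ (Order.le_succ i) hi')
        rintro _ ⟨x, rfl⟩
        exact hfd x
      have hfE : ∀ x, f x ∈ E := fun x => Submodule.mem_sup_left ⟨x, rfl⟩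
      obtain ⟨g, hg, hgc, hgf⟩ := hc.univ i hi E hE (f.codRestrict E hfE)
        (fun a b hab => hf (congrArg Subtype.val hab))
      refine ⟨LinearMap.range (g.prod E.subtype), ?_, ⟨?_, ?_, ?_⟩, ?_, ?_⟩
      · intro p hp
        have h4 := hfp ⟨p, hp⟩
        have h5 := hgf (p₁ ⟨p, hp⟩)
        refine ⟨f.codRestrict E hfE (p₁ ⟨p, hp⟩), Prod.ext ?_ ?_⟩
        · exact h5
        · exact h4
      · rintro y ⟨e, he⟩
        have h4 : g e = 0 := congrArg Prod.fst he
        have h5 : (e : N) = y := congrArg Prod.snd he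
        rw [← h5, hg (h4.trans (map_zero g).symm)]
        rfl
      · rintro x ⟨e, he⟩
        have h4 : g e = x := congrArg Prod.fst he
        have h5 : (e : N) = 0 := congrArg Prod.snd he
        rw [← h4, show e = 0 from Subtype.ext h5, map_zero]
      · rintro - _ ⟨e, rfl⟩
        exact ⟨hgc e, hEd e.2⟩
      · intro x hx
        refine ⟨f ⟨x, hx⟩, f.codRestrict E hfE ⟨x, hx⟩, Prod.ext ?_ rfl⟩
        exact hgf ⟨x, hx⟩
      · intro y hy
        exact ⟨g ⟨y, Submodule.mem_sup_right hy⟩, ⟨y, Submodule.mem_sup_right hy⟩, rfl⟩)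
    (by
      intro i hi hl g hg hP
      refine ⟨fun y hy => ?_, fun x hx => ?_, fun hi' p hp => ?_⟩
      · obtain ⟨j, hj, h⟩ := (Submodule.mem_iSup_Iio hl hg).1 hy
        exact (hP j hj).1 y h
      · obtain ⟨j, hj, h⟩ := (Submodule.mem_iSup_Iio hl hg).1 hx
        exact (hP j hj).2.1 x h
      · obtain ⟨j, hj, h⟩ := (Submodule.mem_iSup_Iio hl hg).1 hp
        have := (hP j hj).2.2 (hj.trans hi') p h
        exact ⟨hc.mono _ _ hj.le hi' this.1, hd.mono _ _ hj.le hi' this.2⟩)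
  obtain ⟨h1, h2, -⟩ := GP κ.ord le_rfl
  obtain ⟨f, hf⟩ := exists_linearMap_of_graph (G κ.ord) h1 (by
    intro x
    obtain ⟨i, hi, hx⟩ := hc.union x
    obtain ⟨y, hy⟩ := (GS i hi).1 x hx
    exact ⟨y, Gm (Order.succ_le_of_lt hi) hy⟩)
  refine ⟨LinearEquiv.ofBijective f ⟨?_, ?_⟩⟩
  · rw [injective_iff_map_eq_zero]
    intro x hx
    refine h2 x ?_
    rw [← hx]; exact hf x
  · intro y
    obtain ⟨i, hi, hy⟩ := hd.union y
    obtain ⟨x, hx⟩ := (GS i hi).2 y hy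
    have h4 := (G κ.ord).sub_mem (hf x) (Gm (Order.succ_le_of_lt hi) hx)
    simp only [Prod.mk_sub_mk, sub_self] at h4
    exact ⟨x, sub_eq_zero.1 (h1 _ h4)⟩

/-! ### Extending homomorphisms from ideals into unions of chains -/

/-- Homomorphisms from left ideals with fewer than `κ` generators to the union of a chain of length
`κ` extend to the ring. -/
theorem IsUnivChain.exists_smul_eq {lam κ : Cardinal.{u}} (hlam : ℵ₀ ≤ lam) (hR : #R ≤ lam)
    (hκ : κ.IsRegular) {c : Ordinal.{u} → Submodule R M} (hc : IsUnivChain lam κ c)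
    {I : Ideal R} (hI : IsLTGenerated κ I) (g : I →ₗ[R] M) :
    ∃ y : M, ∀ a : I, (a : R) • y = g a := by
  obtain ⟨s, hs, hsI⟩ := hI
  have hsI' : ∀ a ∈ s, a ∈ I := fun a ha => hsI ▸ Ideal.subset_span ha
  choose idx hidx hmem using fun a : s => hc.union (g ⟨a, hsI' a a.2⟩)
  -- Regularity of `κ` puts the images of all generators, hence of `I`, in a single term.
  obtain ⟨i, hi, hle⟩ := exists_bound_lt_ord hκ hs idx hidx
  have hle' : Ideal.span s ≤ ((c i).comap g).map I.subtype := by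
    refine Ideal.span_le.2 fun a ha => ?_
    exact ⟨⟨a, hsI' a ha⟩, hc.mono _ _ (hle ⟨a, ha⟩) hi (hmem ⟨a, ha⟩), rfl⟩
  have hg : ∀ a, g a ∈ c i := by
    intro a
    obtain ⟨b, hb, hba⟩ := hle' (hsI.symm.le a.2)
    rwa [← Subtype.ext (a1 := b) (a2 := a) hba]
  obtain ⟨y, -, hy, -⟩ := ((hc.univ i hi).oneUniv hlam hR (hc.card_le i hi)) I
    (g.codRestrict _ hg)
  exact ⟨y, hy⟩

/-- A left ideal without fewer than `κ` generators contains a strictly increasing chain of length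
`κ`. -/
theorem exists_strict_sequence {κ : Cardinal.{u}} {I : Ideal R} (hI : ¬ IsLTGenerated κ I) :
    ∃ a : Ordinal.{u} → R, ∀ i < κ.ord, a i ∉ Ideal.span (a '' Set.Iio i) := by
  classical
  have key : ∀ (i : Ordinal.{u}) (f : Set.Iio i → I), i < κ.ord →
      ∃ x : I, (x : R) ∉ Ideal.span (Set.range fun j => (f j : R)) := by
    intro i f hi
    by_contra hcon
    push Not at hcon
    refine hI ⟨Set.range fun j => (f j : R), ?_, le_antisymm ?_ fun x hx => hcon ⟨x, hx⟩⟩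
    · have h1 := Cardinal.mk_range_le_lift (f := fun j : Set.Iio i => (f j : R))
      rw [Cardinal.mk_Iio_ordinal, Cardinal.lift_lift] at h1
      have h2 := Cardinal.lift_lt.{u, u + 1}.2 (Cardinal.lt_ord.1 hi)
      exact Cardinal.lift_lt.{u, u + 1}.1 (lt_of_le_of_lt (by simpa using h1) h2)
    · rw [Ideal.span_le]
      rintro _ ⟨j, rfl⟩
      exact (f j).2
  let step : (i : Ordinal.{u}) → ((j : Ordinal.{u}) → j < i → I) → I := fun i f =>
    if h : i < κ.ord then (key i (fun j => f j j.2) h).choose else 0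
  let a : Ordinal.{u} → I := fun i => WellFounded.fix Ordinal.lt_wf (C := fun _ => I) step i
  have ha : ∀ i, a i = step i fun j _ => a j := fun i => WellFounded.fix_eq _ _ _
  refine ⟨fun i => (a i : R), fun i hi => ?_⟩
  have h := (key i (fun j => a j) hi).choose_spec
  have h2 : a i = (key i (fun j => a j) hi).choose := by
    rw [ha]; simp only [step, dif_pos hi]
  change (a i : R) ∉ Ideal.span ((fun i => (a i : R)) '' Set.Iio i)
  rw [h2]
  convert h using 3
  ext x
  simp

/-- Diagonalize: on the ideal generated by a strict sequence `a`, build `g` with `g (a i) ∉ c i` for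
all `i < κ.ord`. If `g` were multiplication by `y`, then `y ∈ c i` for some `i`, whence `g (a i) = a
i • y ∈ c i`. -/
theorem IsUnivChain.exists_not_extends {lam κ κ' : Cardinal.{u}} (hlam : ℵ₀ ≤ lam)
    (hR : #R ≤ lam) (hκ : ℵ₀ ≤ κ) (hκ' : κ < κ') {c : Ordinal.{u} → Submodule R M}
    (hc : IsUnivChain lam κ c) (hn : ¬ IsLeftLTNoetherian R κ) :
    ∃ (I : Ideal R) (g : I →ₗ[R] M), IsLTGenerated κ' I ∧
      ¬ ∃ y : M, ∀ a : I, (a : R) • y = g a := by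
  have hlim := Cardinal.isSuccLimit_ord hκ
  obtain ⟨I₀, hI₀⟩ := not_forall.1 hn
  obtain ⟨a, ha⟩ := exists_strict_sequence hI₀
  let I : Ideal R := Ideal.span (a '' Set.Iio κ.ord)
  have hI : IsLTGenerated κ' I := by
    refine ⟨_, ?_, rfl⟩
    have h1 := Cardinal.mk_image_le_lift (f := a) (s := Set.Iio κ.ord)
    rw [Cardinal.mk_Iio_ordinal, Cardinal.card_ord, Cardinal.lift_lift] at h1
    have h2 := Cardinal.lift_lt.{u, u + 1}.2 hκ'
    exact Cardinal.lift_lt.{u, u + 1}.1 (lt_of_le_of_lt (by simpa using h1) h2)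
  have hmono : Monotone fun i => Ideal.span (a '' Set.Iio i) := fun i j hij =>
    Ideal.span_mono (Set.image_mono (Set.Iio_subset_Iio hij))
  obtain ⟨G, G0, Gm, GP, GS, -⟩ := exists_transfinite_chain κ.ord
    (fun i (G : Submodule R (R × M)) => (∀ y, ((0 : R), y) ∈ G → y = 0) ∧
      (∀ p ∈ G, p.1 ∈ Ideal.span (a '' Set.Iio i)) ∧ (i < κ.ord → ∀ p ∈ G, p.2 ∈ c i))
    (fun i _ G => ∃ y, (a i, y) ∈ G ∧ y ∉ c i) ⊥
    (by simp)
    (by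
      rintro i hi G ⟨h1, h2, h3⟩
      have hi' := hlim.succ_lt hi
      obtain ⟨y, -, k1, k2, -, k4⟩ := ((hc.univ i hi).oneUniv hlam hR
        (hc.card_le i hi)).extend_graph (hc.mono _ _ (Order.le_succ i) hi') G h1 (h3 hi) (a i)
      refine ⟨_, le_sup_left, ⟨k1, ?_, fun _ => k2⟩, y,
        Submodule.mem_sup_right (Submodule.mem_span_singleton_self _), fun hy => ?_⟩
      · intro p hp
        obtain ⟨q, hq, r, hr, rfl⟩ := Submodule.mem_sup.1 hp
        obtain ⟨t, rfl⟩ := Submodule.mem_span_singleton.1 hr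
        refine add_mem (hmono (Order.le_succ i) (h2 q hq)) ?_
        exact Ideal.mul_mem_left _ t (Ideal.subset_span ⟨i, Order.lt_succ i, rfl⟩)
      -- A value inside `c i` would put `a i` in the domain built so far, which lies in the span of
      -- the earlier `a j`.
      · obtain ⟨z, hz⟩ := k4 hy
        exact ha i hi (h2 _ hz))
    (by
      intro i hi hl g hg hP
      refine ⟨fun y hy => ?_, fun p hp => ?_, fun hi' p hp => ?_⟩
      · obtain ⟨j, hj, h⟩ := (Submodule.mem_iSup_Iio hl hg).1 hy
        exact (hP j hj).1 y h
      · obtain ⟨j, hj, h⟩ := (Submodule.mem_iSup_Iio hl hg).1 hp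
        exact hmono hj.le ((hP j hj).2.1 p h)
      · obtain ⟨j, hj, h⟩ := (Submodule.mem_iSup_Iio hl hg).1 hp
        exact hc.mono _ _ hj.le hi' ((hP j hj).2.2 (hj.trans hi') p h))
  obtain ⟨h1, -, -⟩ := GP κ.ord le_rfl
  have hdom : I ≤ (G κ.ord).map (LinearMap.fst R R M) := by
    refine Ideal.span_le.2 ?_
    rintro _ ⟨i, hi, rfl⟩
    obtain ⟨y, hy, -⟩ := GS i hi
    exact ⟨_, Gm (Order.succ_le_of_lt hi) hy, rfl⟩
  obtain ⟨g, hg⟩ := exists_linearMap_of_graph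
    ((G κ.ord).comap (I.subtype.prodMap (LinearMap.id : M →ₗ[R] M)))
    (fun y hy => h1 y hy) (by
      intro x
      obtain ⟨⟨x', y⟩, hy, hx⟩ := hdom x.2
      change x' = x at hx
      subst hx
      exact ⟨y, hy⟩)
  refine ⟨I, g, hI, ?_⟩
  rintro ⟨y, hy⟩
  obtain ⟨i, hi, hyi⟩ := hc.union y
  obtain ⟨z, hz, hzi⟩ := GS i hi
  have haI : a i ∈ I := Ideal.subset_span ⟨i, hi, rfl⟩
  have h4 : (a i, g ⟨a i, haI⟩) ∈ G κ.ord := hg ⟨a i, haI⟩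
  have h5 := (G κ.ord).sub_mem h4 (Gm (Order.succ_le_of_lt hi) hz)
  simp only [Prod.mk_sub_mk, sub_self] at h5
  have h6 := sub_eq_zero.1 (h1 _ h5)
  refine hzi ?_
  rw [← h6, ← hy ⟨a i, haI⟩]
  exact (c i).smul_mem _ hyi

/-- Chains of different lengths `κ < κ'` have non-isomorphic unions if `R` is not left
`(< κ)`-noetherian. -/
theorem IsUnivChain.isEmpty_linearEquiv {lam κ κ' : Cardinal.{u}} (hlam : ℵ₀ ≤ lam)
    (hR : #R ≤ lam) (hκ : ℵ₀ ≤ κ) (hκ' : κ'.IsRegular) (hlt : κ < κ')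
    {c : Ordinal.{u} → Submodule R M} {d : Ordinal.{u} → Submodule R N}
    (hc : IsUnivChain lam κ c) (hd : IsUnivChain lam κ' d) (hn : ¬ IsLeftLTNoetherian R κ) :
    IsEmpty (M ≃ₗ[R] N) := by
  refine ⟨fun e => ?_⟩
  obtain ⟨I, g, hI, hg⟩ := hc.exists_not_extends hlam hR hκ hlt hn
  obtain ⟨y, hy⟩ := hd.exists_smul_eq hlam hR hκ' hI (e.toLinearMap ∘ₗ g)
  refine hg ⟨e.symm y, fun a => ?_⟩
  rw [← map_smul, hy a]
  simp

/-- The union of a chain of length `κ` is injective if `R` is left `(< κ)`-noetherian. -/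
theorem IsUnivChain.injective {lam κ : Cardinal.{u}} (hlam : ℵ₀ ≤ lam) (hR : #R ≤ lam)
    (hκ : κ.IsRegular) {c : Ordinal.{u} → Submodule R M} (hc : IsUnivChain lam κ c)
    (hn : IsLeftLTNoetherian R κ) : Module.Injective R M := by
  refine Module.Baer.injective fun I g => ?_
  obtain ⟨y, hy⟩ := hc.exists_smul_eq hlam hR hκ (hn I) g
  exact ⟨LinearMap.toSpanSingleton R M y, fun x hx => hy ⟨x, hx⟩⟩

theorem IsUnivChain.mk_le {lam κ : Cardinal.{u}} (hlam : ℵ₀ ≤ lam) (hκ : κ ≤ lam)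
    {c : Ordinal.{u} → Submodule R M} (hc : IsUnivChain lam κ c) : #M ≤ lam := by
  rw [← Cardinal.mk_univ]
  exact mk_biUnion_ordinal_le hlam (by simpa using hκ) (fun i => (c i : Set M)) hc.card_le _
    fun x _ => hc.union x

/-- Every module of cardinality at most `lam` embeds in the union of a chain. -/
theorem IsUnivChain.exists_embedding {lam κ : Cardinal.{u}} (hlam : ℵ₀ ≤ lam) (hκ : κ ≠ 0)
    {c : Ordinal.{u} → Submodule R M} (hc : IsUnivChain lam κ c) (hP : #P ≤ lam) :
    ∃ f : P →ₗ[R] M, Function.Injective f := by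
  have h0 : 0 < κ.ord := pos_iff_ne_zero.2 (by simpa using hκ)
  obtain ⟨f, hf, -⟩ := (hc.univ 0 h0) (P × c 0) (by
    rw [Cardinal.mk_prod, Cardinal.lift_id, Cardinal.lift_id]
    exact (mul_le_mul' hP (hc.card_le 0 h0)).trans (Cardinal.mul_eq_self hlam).le)
    (LinearMap.inr R P (c 0)) LinearMap.inr_injective
  exact ⟨f ∘ₗ LinearMap.inl R P (c 0), hf.comp LinearMap.inl_injective⟩

end

section
variable {R : Type u} [Ring R] {A B C : Type u} [AddCommGroup A] [Module R A]
  [AddCommGroup B] [Module R B] [AddCommGroup C] [Module R C]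

/-! ### Injective modules that embed in each other -/

theorem Module.Injective.of_retract [Module.Injective R B] (i : A →ₗ[R] B) (p : B →ₗ[R] A)
    (h : ∀ a, p (i a) = a) : Module.Injective R A := by
  refine ⟨fun X Y _ _ _ _ f hf g => ?_⟩
  obtain ⟨k, hk⟩ := Module.Injective.out f hf (i ∘ₗ g)
  exact ⟨p ∘ₗ k, fun x => by simp [hk, h]⟩

theorem Module.Injective.prod [Module.Injective R A] [Module.Injective R B] :
    Module.Injective R (A × B) := by
  refine ⟨fun X Y _ _ _ _ f hf g => ?_⟩
  obtain ⟨k, hk⟩ := Module.Injective.out f hf (LinearMap.fst R A B ∘ₗ g)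
  obtain ⟨l, hl⟩ := Module.Injective.out f hf (LinearMap.snd R A B ∘ₗ g)
  exact ⟨k.prod l, fun x => Prod.ext (hk x) (hl x)⟩

theorem Module.Injective.exists_retraction [Module.Injective R A] (i : A →ₗ[R] B)
    (hi : Function.Injective i) : ∃ p : B →ₗ[R] A, ∀ a, p (i a) = a :=
  Module.Injective.out i hi LinearMap.id

/-- Every element of `E` other than `0` has a nonzero multiple in `D`. -/
def IsEssentialIn (D E : Submodule R B) : Prop :=
  ∀ x ∈ E, x ≠ 0 → ∃ r : R, r • x ∈ D ∧ r • x ≠ 0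

/-- A submodule of an injective module is essential in some direct summand. -/
theorem exists_essential_summand [Module.Injective R B] (D : Submodule R B) :
    ∃ E F : Submodule R B, D ≤ E ∧ IsEssentialIn D E ∧ IsCompl E F := by
  -- `E` is a maximal essential extension of `D` and `F` below is maximal with `E ∩ F = 0`.
  -- Extending the inverse of `E → B / F` to `B / F` gives a map `k` that is the identity on `E` and
  -- `0` on `F`.
  obtain ⟨E, -, hE⟩ := zorn_le_nonempty₀ {E : Submodule R B | D ≤ E ∧ IsEssentialIn D E}
    (by
      intro c hc hchain E₀ hE₀
      refine ⟨sSup c, ⟨(hc hE₀).1.trans (le_sSup hE₀), ?_⟩, fun z hz => le_sSup hz⟩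
      intro x hx hx0
      obtain ⟨E, hE, hxE⟩ := (Submodule.mem_sSup_of_directed ⟨E₀, hE₀⟩ hchain.directedOn).1 hx
      exact (hc hE).2 x hxE hx0)
    D ⟨le_rfl, fun x hx hx0 => ⟨1, by simpa using hx, by simpa using hx0⟩⟩
  obtain ⟨F, -, hF⟩ := zorn_le_nonempty₀ {F : Submodule R B | ∀ x ∈ F, x ∈ E → x = 0}
    (by
      intro c hc hchain F₀ hF₀
      refine ⟨sSup c, ?_, fun z hz => le_sSup hz⟩
      intro x hx hxE
      obtain ⟨F, hF, hxF⟩ := (Submodule.mem_sSup_of_directed ⟨F₀, hF₀⟩ hchain.directedOn).1 hx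
      exact hc hF x hxF hxE)
    ⊥ (by intro x hx _; simpa using hx)
  have hdisj : ∀ x ∈ F, x ∈ E → x = 0 := hF.1
  have hess : ∀ x ∉ F, ∃ r : R, ∃ e ∈ E, e ≠ 0 ∧ r • x - e ∈ F := by
    intro x hx
    by_contra! hcon
    refine hx (hF.2 (y := F ⊔ Submodule.span R {x}) ?_ le_sup_left
      (Submodule.mem_sup_right (Submodule.mem_span_singleton_self x)))
    intro e he heE
    obtain ⟨y, hy, z, hz, rfl⟩ := Submodule.mem_sup.1 he
    obtain ⟨r, rfl⟩ := Submodule.mem_span_singleton.1 hz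
    by_contra hne
    refine hcon r _ heE hne ?_
    have : r • x - (y + r • x) = -y := by abel
    rw [this]; exact F.neg_mem hy
  obtain ⟨h, hh⟩ := Module.Injective.out (F.mkQ ∘ₗ E.subtype) (by
    rw [injective_iff_map_eq_zero]
    rintro ⟨x, hx⟩ hx0
    exact Subtype.ext (hdisj x (by simpa using hx0) hx)) E.subtype
  let k : B →ₗ[R] B := h ∘ₗ F.mkQ
  have kE : ∀ x ∈ E, k x = x := fun x hx => hh ⟨x, hx⟩
  have kF : ∀ x ∈ F, k x = 0 := fun x hx => by
    have : F.mkQ x = 0 := by simpa using hx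
    simp only [k, LinearMap.comp_apply]
    rw [this, map_zero]
  have kmul : ∀ x ∉ F, ∃ r : R, r • k x ∈ E ∧ r • k x ≠ 0 := by
    intro x hx
    obtain ⟨r, e, he, he0, hre⟩ := hess x hx
    have : r • k x = e := by
      have h1 := kF _ hre
      rw [map_sub, map_smul, kE e he] at h1
      exact sub_eq_zero.1 h1
    exact ⟨r, this ▸ he, this ▸ he0⟩
  -- The range of `k` is again essential over `D`, so maximality of `E` makes `k` a projection onto
  -- `E`.
  have krange : ∀ x, k x ∈ E := by
    intro x
    refine hE.2 (y := LinearMap.range k) ⟨?_, ?_⟩ ?_ ⟨x, rfl⟩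
    · exact fun y hy => ⟨y, kE y (hE.1.1 hy)⟩
    · rintro _ ⟨y, rfl⟩ hy0
      obtain ⟨r, hr, hr0⟩ := kmul y fun hyF => hy0 (kF y hyF)
      obtain ⟨s, hs, hs0⟩ := hE.1.2 _ hr hr0
      exact ⟨s * r, by rwa [mul_smul], by rwa [mul_smul]⟩
    · exact fun y hy => ⟨y, kE y hy⟩
  refine ⟨E, F, hE.1.1, hE.1.2, ?_, ?_⟩
  · rw [Submodule.disjoint_def]
    exact fun x hxE hxF => hdisj x hxF hxE
  · rw [codisjoint_iff, eq_top_iff]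
    intro x _
    refine Submodule.mem_sup.2 ⟨k x, krange x, x - k x, ?_, by abel⟩
    by_contra hx
    obtain ⟨r, -, hr⟩ := kmul _ hx
    refine hr ?_
    rw [map_sub, kE _ (krange x), sub_self, smul_zero]

/-- A fixed point `D = f (C × D)` gives `C × D ≅ D`. This passes to an essential extension `E` of
`D` that is a summand of `B`, giving `C × E ≅ E`; adding the complement of `E` yields `C × B ≅ B`.
-/
theorem nonempty_linearEquiv_of_prod_embedding [Module.Injective R B] [Module.Injective R C]
    (f : C × B →ₗ[R] B) (hf : Function.Injective f) : Nonempty ((C × B) ≃ₗ[R] B) := by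
  let Φ : Submodule R B →o Submodule R B :=
    ⟨fun X => ((⊤ : Submodule R C).prod X).map f,
      fun X Y h => Submodule.map_mono (Submodule.prod_mono le_rfl h)⟩
  let D := Φ.lfp
  have hD : ((⊤ : Submodule R C).prod D).map f = D := Φ.map_lfp
  obtain ⟨E, F, hDE, hess, hcompl⟩ := exists_essential_summand D
  have hfD : ∀ (c : C) (d : D), f (c, d) ∈ D := fun c d => by
    have : f (c, d) ∈ ((⊤ : Submodule R C).prod D).map f := ⟨(c, d), ⟨trivial, d.2⟩, rfl⟩
    rwa [hD] at this
  have hE : Module.Injective R E :=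
    Module.Injective.of_retract E.subtype (E.projectionOnto F hcompl)
      (fun a => Submodule.projectionOnto_apply_left hcompl a)
  have hCE : Module.Injective R (C × E) := Module.Injective.prod
  obtain ⟨ψ, hψ⟩ := Module.Injective.out (Q := E)
    ((LinearMap.id : C →ₗ[R] C).prodMap (Submodule.inclusion hDE))
    (Function.Injective.prodMap Function.injective_id (Submodule.inclusion_injective hDE))
    ((f ∘ₗ (LinearMap.id : C →ₗ[R] C).prodMap D.subtype).codRestrict E
      fun p => hDE (hfD p.1 p.2))
  have hψ' : ∀ (c : C) (d : D), (ψ (c, ⟨d, hDE d.2⟩) : B) = f (c, d) :=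
    fun c d => congrArg Subtype.val (hψ (c, d))
  -- `C × D` is essential in `C × E`, and `ψ` agrees there with the injective `f`.
  have hψinj : Function.Injective ψ := by
    rw [injective_iff_map_eq_zero]
    rintro ⟨c, e⟩ h0
    by_contra hne
    obtain ⟨r, hr, hr0⟩ : ∃ r : R, r • (e : B) ∈ D ∧ r • ((c, e) : C × E) ≠ 0 := by
      by_cases he : (e : B) = 0
      · exact ⟨1, by simp [he], by simpa using hne⟩
      · obtain ⟨r, hr, hr0⟩ := hess e e.2 he
        exact ⟨r, hr, fun h => hr0 (congrArg (fun p : C × E => (p.2 : B)) h)⟩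
    refine hr0 ?_
    have h1 : f (r • c, r • (e : B)) = 0 := by
      rw [← hψ' (r • c) ⟨_, hr⟩]
      have : ψ (r • (c, e)) = 0 := by rw [map_smul, h0, smul_zero]
      exact congrArg Subtype.val this
    have h2 : (r • c, r • (e : B)) = 0 := hf (h1.trans (map_zero f).symm)
    have h3 : r • c = 0 := congrArg Prod.fst h2
    have h4 : r • (e : B) = 0 := congrArg Prod.snd h2
    exact Prod.ext h3 (Subtype.ext h4)
  obtain ⟨ρ, hρ⟩ := Module.Injective.exists_retraction ψ hψinj
  -- The range of `ψ` splits off and contains `D`, so its complement meets `D` trivially and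
  -- vanishes by essentiality.
  have hψsurj : Function.Surjective ψ := by
    intro e
    refine ⟨ρ e, ?_⟩
    by_contra hne
    let k := e - ψ (ρ e)
    have hk : ρ k = 0 := by simp [k, hρ]
    have hk0 : (k : B) ≠ 0 := fun h => hne (sub_eq_zero.1 (Subtype.ext h : k = 0)).symm
    obtain ⟨r, hr, hr0⟩ := hess k k.2 hk0
    rw [← hD] at hr
    obtain ⟨⟨c, d⟩, ⟨-, hd⟩, hcd⟩ := hr
    have h1 : ψ (c, ⟨d, hDE hd⟩) = r • k := Subtype.ext ((hψ' c ⟨d, hd⟩).trans hcd)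
    have h2 := hρ (c, ⟨d, hDE hd⟩)
    rw [h1, map_smul, hk, smul_zero] at h2
    rw [← h2, map_zero] at h1
    exact hr0 (congrArg Subtype.val h1).symm
  let eψ := LinearEquiv.ofBijective ψ ⟨hψinj, hψsurj⟩
  let eB := Submodule.prodEquivOfIsCompl E F hcompl
  exact ⟨(LinearEquiv.prodCongr (LinearEquiv.refl R C) eB.symm).trans
    ((LinearEquiv.prodAssoc R C E F).symm.trans
      ((LinearEquiv.prodCongr eψ (LinearEquiv.refl R F)).trans eB))⟩

/-- Injective modules that embed in each other are isomorphic. -/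
theorem Module.Injective.nonempty_linearEquiv [Module.Injective R A] [Module.Injective R B]
    (f : A →ₗ[R] B) (hf : Function.Injective f) (g : B →ₗ[R] A) (hg : Function.Injective g) :
    Nonempty (A ≃ₗ[R] B) := by
  obtain ⟨ρ, hρ⟩ := Module.Injective.exists_retraction g hg
  -- `A ≅ K × B` because `g` splits. Hence `K × B` embeds in `B` through `f`, and the previous
  -- theorem gives `A ≅ K × B ≅ B`.
  let K := LinearMap.ker ρ
  have hK : ∀ k : K, ρ k = 0 := fun k => k.2
  let e : (K × B) →ₗ[R] A := K.subtype.coprod g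
  have he : ∀ p, e p = p.1 + g p.2 := fun p => by simp [e]
  have hinj : Function.Injective e := by
    rw [injective_iff_map_eq_zero]
    rintro ⟨k, b⟩ h
    rw [he] at h
    have h1 := congrArg ρ h
    simp only [map_add, hK, hρ, zero_add, map_zero] at h1
    subst h1
    exact Prod.ext (Subtype.ext (by simpa using h)) rfl
  have hsurj : Function.Surjective e := by
    intro a
    refine ⟨(⟨a - g (ρ a), ?_⟩, ρ a), ?_⟩
    · change ρ _ = 0
      rw [map_sub, hρ, sub_self]
    · rw [he]; simp
  let e' := LinearEquiv.ofBijective e ⟨hinj, hsurj⟩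
  have hKinj : Module.Injective R K :=
    Module.Injective.of_retract K.subtype (LinearMap.fst R K B ∘ₗ e'.symm.toLinearMap) (by
      intro k
      have : e' (k, 0) = k := by change e (k, 0) = k; rw [he]; simp
      have h2 : e'.symm k = (k, 0) := by rw [← this, e'.symm_apply_apply]
      simp only [LinearMap.comp_apply, LinearEquiv.coe_coe, Submodule.subtype_apply]
      rw [h2]; rfl)
  obtain ⟨w⟩ := nonempty_linearEquiv_of_prod_embedding (f ∘ₗ e) (hf.comp hinj)
  exact ⟨e'.symm.trans w⟩

end

section
variable {R : Type u} [Ring R]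

/-! ### Counting limit models -/

theorem IsLeftLTNoetherian.mono {κ κ' : Cardinal.{u}} (h : IsLeftLTNoetherian R κ) (hκ : κ ≤ κ') :
    IsLeftLTNoetherian R κ' := fun I =>
  let ⟨s, hs, hI⟩ := h I
  ⟨s, hs.trans_le hκ, hI⟩

theorem isLeftLTNoetherian_of_mk_lt {κ : Cardinal.{u}} (h : #R < κ) : IsLeftLTNoetherian R κ :=
  fun I => ⟨I, (Cardinal.mk_set_le _).trans_lt h, Ideal.span_eq I⟩

theorem IsLimitModel.exists_isUnivChain {lam : Cardinal.{u}} {M : Type u} [AddCommGroup M]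
    [Module R M] (h : IsLimitModel R lam M) :
    ∃ κ : Cardinal.{u}, κ.IsRegular ∧ κ ≤ lam ∧
      ∃ c : Ordinal.{u} → Submodule R M, IsUnivChain lam κ c := by
  obtain ⟨α, N, hα⟩ := h
  refine ⟨α.cof, Cardinal.isRegular_cof hα.2.1, (Ordinal.cof_le_card α).trans ?_,
    hα.exists_isUnivChain⟩
  exact Order.lt_succ_iff.1 (Cardinal.lt_ord.1 hα.2.2.1)

theorem HasUniversalExtensions.exists_isUnivChain [Nontrivial R] {lam κ : Cardinal.{u}}
    (h : HasUniversalExtensions R lam) (hlam : ℵ₀ ≤ lam) (hR : #R ≤ lam) (hκ : κ.IsRegular)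
    (hκl : κ ≤ lam) : ∃ M : ModuleCat.{u} R, IsLimitModel R lam M ∧
      ∃ c : Ordinal.{u} → Submodule R M, IsUnivChain lam κ c := by
  obtain ⟨M, N, hM⟩ := h.exists_isLimitModelOver hlam hR
    (Cardinal.isSuccLimit_ord hκ.aleph0_le) (Cardinal.ord_lt_ord.2 (Order.lt_succ_iff.2 hκl))
  have hc := hM.exists_isUnivChain
  rw [hκ.cof_ord] at hc
  exact ⟨M, ⟨_, _, hM⟩, hc⟩

theorem IsUnivChain.nonempty_linearEquiv_of_noetherian {lam μ κ κ' : Cardinal.{u}}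
    (hlam : ℵ₀ ≤ lam) (hR : #R ≤ lam) (hn : IsLeftLTNoetherian R μ)
    (hκ : κ.IsRegular) (hκl : κ ≤ lam) (hμκ : μ ≤ κ)
    (hκ' : κ'.IsRegular) (hκl' : κ' ≤ lam) (hμκ' : μ ≤ κ')
    {M N : Type u} [AddCommGroup M] [Module R M] [AddCommGroup N] [Module R N]
    {c : Ordinal.{u} → Submodule R M} {d : Ordinal.{u} → Submodule R N}
    (hc : IsUnivChain lam κ c) (hd : IsUnivChain lam κ' d) : Nonempty (M ≃ₗ[R] N) := by
  have := hc.injective hlam hR hκ (hn.mono hμκ)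
  have := hd.injective hlam hR hκ' (hn.mono hμκ')
  obtain ⟨f, hf⟩ := hd.exists_embedding (P := M) hlam hκ'.ne_zero (hc.mk_le hlam hκl)
  obtain ⟨g, hg⟩ := hc.exists_embedding (P := N) hlam hκ.ne_zero (hd.mk_le hlam hκl')
  exact Module.Injective.nonempty_linearEquiv f hf g hg

theorem isRegular_aleph_natCast (k : ℕ) : (ℵ_ (k : Ordinal.{u})).IsRegular := by
  cases k with
  | zero => simpa using Cardinal.isRegular_aleph0
  | succ k =>
    rw [Nat.cast_succ]
    exact Cardinal.isRegular_aleph_add_one _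

/-- Label a model by `k` if its chain has length `ℵ_k < ℵ_n`, and by `n` otherwise. Equal labels
give isomorphic models: by back-and-forth below `n`, by injectivity at `n`. -/
theorem numLimitModels_le {lam : Cardinal.{u}} (hlam : ℵ₀ ≤ lam) (hR : #R ≤ lam) {n : ℕ}
    (hn : IsLeftLTNoetherian R (ℵ_ (n : Ordinal.{u}))) :
    numLimitModels R lam ≤ (n : Cardinal.{u + 1}) + 1 := by
  have key : ∀ C : {C : Quotient (CategoryTheory.isIsomorphicSetoid (ModuleCat.{u} R)) |
      ∃ M : ModuleCat.{u} R, IsLimitModel R lam M ∧ Quotient.mk _ M = C},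
      ∃ (k : Fin (n + 1)) (M : ModuleCat.{u} R) (κ : Cardinal.{u}) (c : Ordinal.{u} → Submodule R M),
        Quotient.mk _ M = C.1 ∧ κ.IsRegular ∧ κ ≤ lam ∧ IsUnivChain lam κ c ∧
        (κ = ℵ_ ((k : ℕ) : Ordinal.{u}) ∨ ((k : ℕ) = n ∧ ℵ_ (n : Ordinal.{u}) ≤ κ)) := by
    rintro ⟨C, M, hM, hC⟩
    obtain ⟨κ, hκ, hκl, c, hc⟩ := hM.exists_isUnivChain
    by_cases hlt : κ < ℵ_ (n : Ordinal.{u})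
    · obtain ⟨o, rfl⟩ := Cardinal.mem_range_aleph_iff.2 hκ.aleph0_le
      rw [Cardinal.aleph_lt_aleph] at hlt
      obtain ⟨k, rfl⟩ := Ordinal.lt_omega0.1 (hlt.trans (Ordinal.natCast_lt_omega0 n))
      rw [Nat.cast_lt] at hlt
      exact ⟨⟨k, hlt.trans (Nat.lt_succ_self n)⟩, M, _, c, hC, hκ, hκl, hc, Or.inl rfl⟩
    · exact ⟨Fin.last n, M, κ, c, hC, hκ, hκl, hc, Or.inr ⟨rfl, not_lt.1 hlt⟩⟩
  choose k M κ c hMC hκ hκl hc hk using key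
  have hinj : Function.Injective k := by
    intro C C' h
    have hiso : Nonempty (M C ≃ₗ[R] M C') := by
      by_cases hkn : (k C : ℕ) = n
      · refine IsUnivChain.nonempty_linearEquiv_of_noetherian hlam hR hn (hκ C) (hκl C) ?_
          (hκ C') (hκl C') ?_ (hc C) (hc C')
        · rcases hk C with h1 | h1
          · rw [h1, hkn]
          · exact h1.2
        · rcases hk C' with h1 | h1
          · rw [h1, ← h, hkn]
          · exact h1.2
      · have h1 := (hk C).resolve_right fun h2 => hkn h2.1
        have h2 := (hk C').resolve_right fun h2 => hkn (h ▸ h2.1)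
        have h3 : κ C' = κ C := by rw [h1, h2, h]
        have h4 := hc C'
        rw [h3] at h4
        exact (hc C).nonempty_linearEquiv hlam (hκ C).aleph0_le h4
    obtain ⟨e⟩ := hiso
    refine Subtype.ext ?_
    rw [← hMC C, ← hMC C']
    exact Quotient.sound ⟨e.toModuleIso⟩
  have := Cardinal.lift_mk_le_lift_mk_of_injective hinj
  simpa [numLimitModels] using this

/-- The models for `ℵ_0, …, ℵ_n` are pairwise non-isomorphic: of two lengths the smaller is some
`ℵ_k` with `k < n`, where noetherianity fails. -/
theorem le_numLimitModels [Nontrivial R] {lam : Cardinal.{u}} (hlam : Order.succ (#R + ℵ₀) ≤ lam)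
    (h : HasUniversalExtensions R lam) {n : ℕ}
    (hn : ∀ m : ℕ, n = m + 1 → ¬ IsLeftLTNoetherian R (ℵ_ (m : Ordinal.{u}))) :
    (n : Cardinal.{u + 1}) + 1 ≤ numLimitModels R lam := by
  have hR' : #R + ℵ₀ ≤ lam := (Order.le_succ _).trans hlam
  have hR : #R ≤ lam := le_self_add.trans hR'
  have hlam₀ : ℵ₀ ≤ lam := le_add_self.trans hR'
  have hn' : ∀ k < n, ¬ IsLeftLTNoetherian R (ℵ_ (k : Ordinal.{u})) := by
    intro k hk hcon
    obtain ⟨m, rfl⟩ := Nat.exists_eq_succ_of_ne_zero (Nat.ne_zero_of_lt hk)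
    refine hn m rfl (hcon.mono ?_)
    rw [Cardinal.aleph_le_aleph, Nat.cast_le]
    exact Nat.lt_succ_iff.1 hk
  -- This is where `lam` must be at least the successor: failure at `ℵ_m` forces `ℵ_m ≤ #R + ℵ₀`,
  -- hence `ℵ_(m+1) ≤ lam`.
  have hle : ∀ k ≤ n, ℵ_ (k : Ordinal.{u}) ≤ lam := by
    intro k hk
    cases k with
    | zero => simpa using hlam₀
    | succ m =>
      rw [Nat.cast_succ, ← Cardinal.succ_aleph]
      refine (Order.succ_le_succ ?_).trans hlam
      by_contra hcon
      exact hn' m hk (isLeftLTNoetherian_of_mk_lt (le_self_add.trans_lt (not_le.1 hcon)))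
  choose M hM c hc using fun k : Fin (n + 1) =>
    h.exists_isUnivChain hlam₀ hR (isRegular_aleph_natCast k) (hle k (Nat.lt_succ_iff.1 k.2))
  let F : Fin (n + 1) → {C : Quotient (CategoryTheory.isIsomorphicSetoid (ModuleCat.{u} R)) |
      ∃ M : ModuleCat.{u} R, IsLimitModel R lam M ∧ Quotient.mk _ M = C} :=
    fun k => ⟨Quotient.mk _ (M k), M k, hM k, rfl⟩
  have hne : ∀ k k' : Fin (n + 1), k < k' → F k ≠ F k' := by
    intro k k' hlt heq
    have h1 : Quotient.mk (CategoryTheory.isIsomorphicSetoid (ModuleCat.{u} R)) (M k) =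
      Quotient.mk _ (M k') := congrArg Subtype.val heq
    obtain ⟨e⟩ := Quotient.exact h1
    have := IsUnivChain.isEmpty_linearEquiv hlam₀ hR (isRegular_aleph_natCast k).aleph0_le
      (isRegular_aleph_natCast k')
      (Cardinal.aleph_lt_aleph.2 (Nat.cast_lt.2 hlt)) (hc k) (hc k')
      (hn' k (lt_of_lt_of_le hlt (Nat.lt_succ_iff.1 k'.2)))
    exact this.false e.toLinearEquiv
  have hinj : Function.Injective F := by
    intro k k' hkk'
    rcases lt_trichotomy k k' with hlt | rfl | hlt
    · exact absurd hkk' (hne _ _ hlt)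
    · rfl
    · exact absurd hkk'.symm (hne _ _ hlt)
  have := Cardinal.lift_mk_le_lift_mk_of_injective hinj
  simpa [numLimitModels] using this

theorem HasUniversalExtensions.isStableIn [Nontrivial R] {lam : Cardinal.{u}}
    (h : HasUniversalExtensions R lam) (hlam : ℵ₀ ≤ lam) (hR : #R ≤ lam) : IsStableIn R lam :=
  let ⟨M, hM, _⟩ := h.exists_isUnivChain hlam hR Cardinal.isRegular_aleph0 hlam
  ⟨M, hM⟩

theorem hasUniversalExtensions_two_power (R : Type u) [Ring R] :
    HasUniversalExtensions R (2 ^ (#R + ℵ₀)) := by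
  have h0 : ℵ₀ ≤ #R + ℵ₀ := le_add_self
  have hR : #R ≤ #R + ℵ₀ := le_self_add
  refine hasUniversalExtensions_of_power (h0.trans (Cardinal.cantor _).le)
    (Cardinal.power_le_power_left two_ne_zero hR) ?_
  rw [← Cardinal.power_mul]
  exact Cardinal.power_le_power_left two_ne_zero
    ((mul_le_mul' le_rfl hR).trans (Cardinal.mul_eq_self h0).le)

end

/-! ### The equivalence -/

theorem theorem3p17 (R : Type u) [Ring R] [Nontrivial R] (n : ℕ) :
    List.TFAE [
      IsLeftLTNoetherian R (ℵ_ (n : Ordinal.{u})) ∧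
        (∀ m : ℕ, n = m + 1 → ¬ IsLeftLTNoetherian R (ℵ_ (m : Ordinal.{u}))),
      ∀ lam : Cardinal.{u}, Order.succ (#R + ℵ₀) ≤ lam → IsStableIn R lam →
        numLimitModels R lam = (n : Cardinal.{u + 1}) + 1,
      numLimitModels R (2 ^ (#R + ℵ₀)) = (n : Cardinal.{u + 1}) + 1] := by
  have hsucc : Order.succ (#R + ℵ₀) ≤ 2 ^ (#R + ℵ₀) := Order.succ_le_of_lt (Cardinal.cantor _)
  have hbd : ∀ lam : Cardinal.{u}, Order.succ (#R + ℵ₀) ≤ lam → ℵ₀ ≤ lam ∧ #R ≤ lam :=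
    fun lam h => ⟨le_add_self.trans ((Order.le_succ _).trans h),
      le_self_add.trans ((Order.le_succ _).trans h)⟩
  have hU := hasUniversalExtensions_two_power R
  obtain ⟨h0, hR⟩ := hbd _ hsucc
  tfae_have 1 → 2 := fun ⟨h1, h2⟩ lam hlam hst =>
    le_antisymm (numLimitModels_le (hbd lam hlam).1 (hbd lam hlam).2 h1)
      (le_numLimitModels hlam hst.hasUniversalExtensions h2)
  tfae_have 2 → 3 := fun h => h _ hsucc (hU.isStableIn h0 hR)
  tfae_have 3 → 1 := by
    intro h
    refine ⟨?_, ?_⟩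
    -- Failure at `ℵ_n` would produce at least `n + 2` models.
    · by_contra hn
      have h1 := le_numLimitModels hsucc hU (n := n + 1) (by
        intro m hm
        obtain rfl : n = m := Nat.succ_injective hm
        exact hn)
      rw [h] at h1
      norm_cast at h1
      omega
    -- Noetherianity at `ℵ_m` would allow at most `m + 1` models, against the assumed `m + 2`.
    · rintro m rfl hm
      have h1 := numLimitModels_le h0 hR hm
      rw [h] at h1
      norm_cast at h1
      omega
  tfae_finish
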